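/- **Conventions.** Let $(\Omega,\Sigma,\mu)$ be a $\sigma$-finite measure space and $L^0=L^0(\mu)$ the space of classes of real measurable functions. A *Banach ideal space* $E$ on $\Omega$ is a linear subspace of $L^0$ with a complete norm such that $|x|\le|y|$ a.e., $y\in E$, $x\in L^0$ imply $x\in E$ and $\|x\|_E\le\|y\|_E$, and such that every set of positive measure has a measurable subset $B$ with $0<\mu(B)<\infty$ and $\chi_B\in E$. It has the *Fatou property* if $x_n\in E$, $0\le x_n\uparrow x\in L^0$ and $\sup_n\|x_n\|_E<\infty$ imply $x\in E$ and $\|x_n\|_E\uparrow\|x\|_E$. $E_a$ is the set of those $x\in E$ for which $\|x_n\|_E\to0$ whenever $x_n\in E$, $0\le x_n\le|x|$ and $x_n\to0$ a.e.; $E$ has *order continuous norm* if $E_a=E$; and $\operatorname{supp}E_a=\Omega$ means that there is no set of positive measure on which all elements of $E_a$ vanish a.e. $E$ is *symmetric* if $x\in E$, $y\in L^0$ and $\mu\{|x|>\lambda\}=\mu\{|y|>\lambda\}$ for all $\lambda\ge0$ imply $y\in E$ and $\|x\|_E=\|y\|_E$. A symmetric Banach function space on $I$ is a symmetric Banach ideal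 space on $I=(0,1)$ or $I=(0,\infty)$ with Lebesgue measure; a symmetric Banach sequence space is a symmetric Banach ideal space on $\mathbb N$ with counting measure. $X\hookrightarrow Y$ means that $X\subset Y$ and $\|x\|_Y\le C\|x\|_X$ for all $x\in X$ with some constant $C>0$. A *Young function* is a convex, non-decreasing $\varphi:[0,\infty)\to[0,\infty]$ with $\varphi(0)=0$, neither identically zero nor identically infinite on $(0,\infty)$, with $\lim_{u\to b_\varphi^-}\varphi(u)=\varphi(b_\varphi)$ if $b_\varphi=\sup\{u>0:\varphi(u)<\infty\}<\infty$. Put $\varphi^{-1}(v)=\inf\{u\ge0:\varphi(u)>v\}$ for $0\le v<\infty$. We write $\varphi^{-1}\prec\varphi_1^{-1}\varphi_2^{-1}$ for all arguments [for large arguments] (for small arguments) if there is $D>0$ [there are $D,u_0>0$] (there are $D,u_0>0$) such that $\varphi^{-1}(u)\le D\,\varphi_1^{-1}(u)\,\varphi_2^{-1}(u)$ for all $u>0$ [for all $u\ge u_0$] (for all $0<u\le u_0$). Let $I_\varphi(x)=\|\varphi(|x|)\|_E$ if $\varphi(|x|)\in E$ and $I_\varphi(x)=\infty$ otherwise. The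 Calderón–Lozanovskiĭ space is $E_\varphi=\{x\in L^0: I_\varphi(cx)<\infty\text{ for some }c>0\}$ with $\|x\|_{E_\varphi}=\inf\{\lambda>0: I_\varphi(x/\lambda)\le1\}$. The product space is $E\odot F=\{xy:x\in E,\ y\in F\}$ with $\|z\|_{E\odot F}=\inf\{\|x\|_E\|y\|_F: z=xy,\ x\in E,\ y\in F\}$. **Theorem 5.** Let $\varphi_1,\varphi_2,\varphi$ be three Young functions. (a) If $E$ is a Banach ideal space with the Fatou property and one of the following conditions holds: (a1) $\varphi^{-1}\prec\varphi_1^{-1}\varphi_2^{-1}$ for all arguments, (a2) $\varphi^{-1}\prec\varphi_1^{-1}\varphi_2^{-1}$ for large arguments and $L^\infty\hookrightarrow E$, (a3) $\varphi^{-1}\prec\varphi_1^{-1}\varphi_2^{-1}$ for small arguments and $E\hookrightarrow L^\infty$, then $E_\varphi\hookrightarrow E_{\varphi_1}\odot E_{\varphi_2}$. (b) If $E$ is a symmetric Banach function space on $I$ with the Fatou property, $E_a\ne\{0\}$ and $E_\varphi\hookrightarrow E_{\varphi_1}\odot E_{\varphi_2}$, then $\varphi^{-1}\prec\varphi_1^{-1}\varphi_2^{-1}$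 for large arguments. (c) If $E$ is a symmetric Banach function space on $I$ with the Fatou property, $\operatorname{supp}E_a=I$, $L^\infty\not\hookrightarrow E$ and $E_\varphi\hookrightarrow E_{\varphi_1}\odot E_{\varphi_2}$, then $\varphi^{-1}\prec\varphi_1^{-1}\varphi_2^{-1}$ for small arguments. (d) If $e$ is a symmetric Banach sequence space with the Fatou property and order continuous norm and $e_\varphi\hookrightarrow e_{\varphi_1}\odot e_{\varphi_2}$, then $\varphi^{-1}\prec\varphi_1^{-1}\varphi_2^{-1}$ for small arguments. -/

import Mathlib

open MeasureTheory Filter Set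
open scoped NNReal ENNReal Topology

noncomputable section

namespace CalderonLozanovskii

/-! ### Young functions -/

/-- A Young function `φ : [0, ∞) → [0, ∞]`: convex, non-decreasing, `φ 0 = 0`, neither identically
zero nor identically infinite on `(0, ∞)`, and left-continuous at
`b_φ = sup {u > 0 : φ u < ∞}` if `b_φ < ∞`. -/
structure YoungFunction where
  toFun : ℝ≥0 → ℝ≥0∞
  convex : ConvexOn ℝ≥0 univ toFun
  mono : Monotone toFun
  map_zero : toFun 0 = 0
  not_zero : ∃ u : ℝ≥0, 0 < u ∧ toFun u ≠ 0
  not_top : ∃ u : ℝ≥0, 0 < u ∧ toFun u ≠ ⊤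
  leftCont : ∀ b : ℝ≥0, IsLUB {u : ℝ≥0 | 0 < u ∧ toFun u < ⊤} b →
    Tendsto toFun (𝓝[<] b) (𝓝 (toFun b))

namespace YoungFunction

/-- The right-continuous inverse `φ⁻¹(v) = inf {u ≥ 0 : φ u > v}`, `v ∈ [0, ∞)`. The set is never
empty, because a Young function tends to infinity. -/
def rinv (φ : YoungFunction) (v : ℝ≥0) : ℝ≥0 :=
  sInf {u : ℝ≥0 | (v : ℝ≥0∞) < φ.toFun u}

/-- `φ⁻¹ ≺ φ₁⁻¹ φ₂⁻¹` for all arguments. -/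
def PrecAll (φ φ₁ φ₂ : YoungFunction) : Prop :=
  ∃ D : ℝ≥0, 0 < D ∧ ∀ u : ℝ≥0, 0 < u → φ.rinv u ≤ D * φ₁.rinv u * φ₂.rinv u

/-- `φ⁻¹ ≺ φ₁⁻¹ φ₂⁻¹` for large arguments. -/
def PrecLarge (φ φ₁ φ₂ : YoungFunction) : Prop :=
  ∃ D u₀ : ℝ≥0, 0 < D ∧ 0 < u₀ ∧
    ∀ u : ℝ≥0, u₀ ≤ u → φ.rinv u ≤ D * φ₁.rinv u * φ₂.rinv u

/-- `φ⁻¹ ≺ φ₁⁻¹ φ₂⁻¹` for small arguments. -/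
def PrecSmall (φ φ₁ φ₂ : YoungFunction) : Prop :=
  ∃ D u₀ : ℝ≥0, 0 < D ∧ 0 < u₀ ∧
    ∀ u : ℝ≥0, 0 < u → u ≤ u₀ → φ.rinv u ≤ D * φ₁.rinv u * φ₂.rinv u

theorem measurable_comp (φ : YoungFunction) :
    Measurable (fun s : ℝ => (φ.toFun ‖s‖₊).toReal) :=
  (φ.mono.measurable.comp measurable_nnnorm).ennreal_toReal

end YoungFunction

/-! ### Spaces of classes of measurable functions -/

variable {Ω : Type*} [MeasurableSpace Ω] {μ : Measure Ω}

/-- A set of classes of real measurable functions together with a real functional; only the values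
of `norm` on `carrier` matter. The laws of a Banach ideal space are in `IsBanachIdeal`. -/
structure FnSpace (μ : Measure Ω) where
  carrier : Set (Ω →ₘ[μ] ℝ)
  norm : (Ω →ₘ[μ] ℝ) → ℝ

namespace FnSpace

/-- The class of the characteristic function of a measurable set. -/
def chi (μ : Measure Ω) (B : Set Ω) (hB : MeasurableSet B) : Ω →ₘ[μ] ℝ :=
  AEEqFun.mk (B.indicator fun _ => (1 : ℝ))
    (measurable_const.indicator hB).aestronglyMeasurable

/-- `E` is a Banach ideal space: a linear subspace of `L⁰(μ)` with a complete norm, which has the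
ideal property and is saturated. -/
structure IsBanachIdeal (E : FnSpace μ) : Prop where
  zero_mem : (0 : Ω →ₘ[μ] ℝ) ∈ E.carrier
  add_mem : ∀ x ∈ E.carrier, ∀ y ∈ E.carrier, x + y ∈ E.carrier
  smul_mem : ∀ c : ℝ, ∀ x ∈ E.carrier, c • x ∈ E.carrier
  norm_nonneg : ∀ x ∈ E.carrier, 0 ≤ E.norm x
  norm_eq_zero : ∀ x ∈ E.carrier, E.norm x = 0 → x = 0
  norm_smul : ∀ c : ℝ, ∀ x ∈ E.carrier, E.norm (c • x) = |c| * E.norm x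
  norm_add_le : ∀ x ∈ E.carrier, ∀ y ∈ E.carrier, E.norm (x + y) ≤ E.norm x + E.norm y
  complete : ∀ x : ℕ → Ω →ₘ[μ] ℝ, (∀ n, x n ∈ E.carrier) →
    (∀ ε : ℝ, 0 < ε → ∃ N, ∀ m ≥ N, ∀ n ≥ N, E.norm (x m - x n) < ε) →
    ∃ z ∈ E.carrier, Tendsto (fun n => E.norm (x n - z)) atTop (𝓝 0)
  ideal : ∀ y ∈ E.carrier, ∀ x : Ω →ₘ[μ] ℝ, (∀ᵐ t ∂μ, |x t| ≤ |y t|) →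
    x ∈ E.carrier ∧ E.norm x ≤ E.norm y
  saturated : ∀ A : Set Ω, MeasurableSet A → 0 < μ A →
    ∃ (B : Set Ω) (hB : MeasurableSet B), B ⊆ A ∧ 0 < μ B ∧ μ B < ⊤ ∧ chi μ B hB ∈ E.carrier

/-- The Fatou property. -/
def Fatou (E : FnSpace μ) : Prop :=
  ∀ (x : ℕ → Ω →ₘ[μ] ℝ) (z : Ω →ₘ[μ] ℝ), (∀ n, x n ∈ E.carrier) →
    (∀ᵐ t ∂μ, (∀ n, 0 ≤ x n t) ∧ Monotone (fun n => x n t) ∧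
      Tendsto (fun n => x n t) atTop (𝓝 (z t))) →
    BddAbove (range fun n => E.norm (x n)) →
    z ∈ E.carrier ∧ Tendsto (fun n => E.norm (x n)) atTop (𝓝 (E.norm z))

/-- `E_a`, the set of the elements of `E` with order continuous norm. -/
def orderCont (E : FnSpace μ) : Set (Ω →ₘ[μ] ℝ) :=
  {x | x ∈ E.carrier ∧ ∀ y : ℕ → Ω →ₘ[μ] ℝ, (∀ n, y n ∈ E.carrier) →
    (∀ᵐ t ∂μ, (∀ n, 0 ≤ y n t ∧ y n t ≤ |x t|) ∧ Tendsto (fun n => y n t) atTop (𝓝 0)) →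
    Tendsto (fun n => E.norm (y n)) atTop (𝓝 0)}

/-- `supp S = Ω`: no set of positive measure on which all elements of `S` vanish. -/
def FullSupport (S : Set (Ω →ₘ[μ] ℝ)) : Prop :=
  ∀ A : Set Ω, MeasurableSet A → 0 < μ A → ∃ x ∈ S, ¬ ∀ᵐ t ∂μ, t ∈ A → x t = 0

/-- The distribution functions of `x` and `y` are equal. -/
def Equimeasurable (x y : Ω →ₘ[μ] ℝ) : Prop :=
  ∀ l : ℝ, 0 ≤ l → μ {t | l < |x t|} = μ {t | l < |y t|}

/-- The norm of `E` is invariant under equimeasurability. -/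
def Symmetric (E : FnSpace μ) : Prop :=
  ∀ x y : Ω →ₘ[μ] ℝ, Equimeasurable x y → x ∈ E.carrier → y ∈ E.carrier ∧ E.norm x = E.norm y

/-- `X ↪ Y`: inclusion with `‖x‖_Y ≤ C ‖x‖_X` for some constant `C > 0`. -/
def Embeds (X Y : FnSpace μ) : Prop :=
  ∃ C : ℝ, 0 < C ∧ ∀ x ∈ X.carrier, x ∈ Y.carrier ∧ Y.norm x ≤ C * X.norm x

/-- The space `L^∞(μ)` with the essential supremum norm. -/
def Linfty (μ : Measure Ω) : FnSpace μ where
  carrier := {x | eLpNorm x ⊤ μ < ⊤}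
  norm x := (eLpNorm x ⊤ μ).toReal

/-- The pointwise product space `X ⊙ Y`. -/
def prod (X Y : FnSpace μ) : FnSpace μ where
  carrier := {z | ∃ x ∈ X.carrier, ∃ y ∈ Y.carrier, z = x * y}
  norm z := sInf {r : ℝ | ∃ x ∈ X.carrier, ∃ y ∈ Y.carrier, z = x * y ∧ r = X.norm x * Y.norm y}

/-- The class of `t ↦ φ(|x t|)`, meaningful if this function is finite almost everywhere. -/
def compAbs (φ : YoungFunction) (x : Ω →ₘ[μ] ℝ) : Ω →ₘ[μ] ℝ :=
  x.compMeasurable (fun s : ℝ => (φ.toFun ‖s‖₊).toReal) φ.measurable_comp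

open Classical in
/-- The modular `I_φ(x)`: the norm of `φ(|x|)` if `φ(|x|) ∈ E`, and `∞` otherwise. -/
def modular (E : FnSpace μ) (φ : YoungFunction) (x : Ω →ₘ[μ] ℝ) : ℝ≥0∞ :=
  if (∀ᵐ t ∂μ, φ.toFun ‖x t‖₊ < ⊤) ∧ compAbs φ x ∈ E.carrier then
    ENNReal.ofReal (E.norm (compAbs φ x))
  else ⊤

/-- The Calderón–Lozanovskiĭ space `E_φ` with the Luxemburg–Nakano norm. -/
def calderon (E : FnSpace μ) (φ : YoungFunction) : FnSpace μ where
  carrier := {x | ∃ c : ℝ, 0 < c ∧ E.modular φ (c • x) < ⊤}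
  norm x := sInf {l : ℝ | 0 < l ∧ E.modular φ (l⁻¹ • x) ≤ 1}

end FnSpace

end CalderonLozanovskii

end

/-!
Sufficiency. Let `I_φ(x) ≤ 1` and let `g = φ(|x|)` or, when the inequality between the inverses
holds for large arguments only, `g = φ(|x|) + u₀`, which is in `E` because constants are. Then
`|x| ≤ φ⁻¹(g) ≤ D φ₁⁻¹(g) φ₂⁻¹(g)` almost everywhere, and `φᵢ(φᵢ⁻¹(g)) ≤ g` by the left continuity
of `φᵢ` (`YoungFunction.map_rinv_le`), so that `φ₁⁻¹(g)` and `φ₂⁻¹(g)` provide the factors of `x`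
(`FnSpace.embeds_prod_of_majorant`). When `E ↪ L^∞`, the values of `g` are bounded, and on a bounded
interval the inequality for small arguments extends to all arguments (`PrecSmall.exists_le`); the
value `0` is reached by right continuity.

Necessity. Let `A` be a set with `‖χ_A‖_E` equal to `1 / u` up to a factor `2`. Then
`x = φ⁻¹(u) χ_A` has modular at most `1`, so that up to a constant `x = y z` with
`I_φ₁(y) ≤ 1` and `I_φ₂(z) ≤ 1`. No averaging operator is needed: for each `s`, on at least half of
`A` one has `|y| ≥ s` or `|z| ≥ c / s`, where `c` is the value of `|y z|` on `A`. In a symmetric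
space half of `A` has at least half of the norm of `A`, and the bound on the modulars gives
`c ≤ 16 φ₁⁻¹(u) φ₂⁻¹(u)` (`FnSpace.IsTestSet.le_rinv_mul_rinv`). It remains to find enough such
sets, along a sequence of sets of measures in geometric progression, whose norms change at most by
a factor `2` in each step. A nonzero element of `E_a` makes the norms of small sets tend to `0`,
which gives all large `u`. If the norms of large sets were bounded, then the Fatou property would
put `1` into `E`, hence `L^∞ ↪ E`; for sequence spaces this contradicts the order continuity of the
norm. So these norms are unbounded, which gives all small `u`.
-/

namespace CalderonLozanovskii

/-! ### Young functions and their inverses -/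

namespace YoungFunction

variable (φ : YoungFunction)

theorem map_mul_le {t : ℝ≥0} (ht : t ≤ 1) (u : ℝ≥0) : φ.toFun (t * u) ≤ t * φ.toFun u := by
  have h := φ.convex.2 (mem_univ u) (mem_univ 0) zero_le zero_le
    (add_tsub_cancel_of_le ht)
  simpa [φ.map_zero, ENNReal.smul_def] using h

theorem le_map_mul {k : ℝ≥0} (hk : 1 ≤ k) (u : ℝ≥0) : k * φ.toFun u ≤ φ.toFun (k * u) := by
  have hk0 : k ≠ 0 := (zero_lt_one.trans_le hk).ne'
  have h := φ.map_mul_le (inv_le_one_of_one_le₀ hk) (k * u)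
  rw [inv_mul_cancel_left₀ hk0] at h
  calc (k : ℝ≥0∞) * φ.toFun u ≤ k * ((k⁻¹ : ℝ≥0) * φ.toFun (k * u)) := by gcongr
    _ = φ.toFun (k * u) := by
      rw [← mul_assoc, ← ENNReal.coe_mul, mul_inv_cancel₀ hk0, ENNReal.coe_one, one_mul]

theorem exists_lt_map (v : ℝ≥0) : ∃ u : ℝ≥0, (v : ℝ≥0∞) < φ.toFun u := by
  obtain ⟨u, -, hu⟩ := φ.not_zero
  obtain ⟨n, hn⟩ := ENNReal.exists_nat_mul_gt hu (ENNReal.coe_ne_top (r := v))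
  refine ⟨((n + 1 : ℕ) : ℝ≥0) * u, hn.trans_le ?_⟩
  refine le_trans ?_ (φ.le_map_mul (by simp) u)
  gcongr
  simp

theorem map_le_of_lt_rinv {u v : ℝ≥0} (h : u < φ.rinv v) : φ.toFun u ≤ v :=
  not_lt.1 fun h' => (csInf_le (OrderBot.bddBelow {u | (v : ℝ≥0∞) < φ.toFun u}) h').not_gt h

theorem lt_map_of_rinv_lt {u v : ℝ≥0} (h : φ.rinv v < u) : (v : ℝ≥0∞) < φ.toFun u := by
  obtain ⟨w, hw, hwu⟩ := exists_lt_of_csInf_lt (φ.exists_lt_map v) h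
  exact lt_of_lt_of_le hw (φ.mono hwu.le)

theorem rinv_le_of_lt_map {u v : ℝ≥0} (h : (v : ℝ≥0∞) < φ.toFun u) : φ.rinv v ≤ u :=
  csInf_le (OrderBot.bddBelow _) h

theorem le_rinv_of_map_le {u v : ℝ≥0} (h : φ.toFun u ≤ v) : u ≤ φ.rinv v :=
  not_lt.1 fun h' => (φ.lt_map_of_rinv_lt h').not_ge h

theorem rinv_mono : Monotone φ.rinv := fun v w hvw =>
  le_csInf (φ.exists_lt_map w) fun _ hu =>
    φ.rinv_le_of_lt_map (lt_of_le_of_lt (by exact_mod_cast hvw) hu)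

theorem rinv_mul_le {k : ℝ≥0} (hk : 1 ≤ k) (v : ℝ≥0) : φ.rinv (k * v) ≤ k * φ.rinv v := by
  have hk0 : 0 < k := zero_lt_one.trans_le hk
  rw [← div_le_iff₀' hk0]
  refine le_csInf (φ.exists_lt_map v) fun u hu => ?_
  rw [div_le_iff₀' hk0]
  refine φ.rinv_le_of_lt_map (lt_of_lt_of_le ?_ (φ.le_map_mul hk u))
  rw [ENNReal.coe_mul]
  exact (ENNReal.mul_lt_mul_iff_right (by exact_mod_cast hk0.ne') ENNReal.coe_ne_top).2 hu

theorem rinv_pos {v : ℝ≥0} (hv : 0 < v) : 0 < φ.rinv v := by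
  obtain ⟨u, hu, hu'⟩ := φ.not_top
  lift φ.toFun u to ℝ≥0 using hu' with a ha
  have ht : v / (a + v) ≤ 1 := div_le_one_of_le₀ (by simp) zero_le
  refine lt_of_lt_of_le (b := v / (a + v) * u) (by positivity) (φ.le_rinv_of_map_le ?_)
  refine (φ.map_mul_le ht u).trans ?_
  rw [← ha]
  norm_cast
  rw [div_mul_eq_mul_div, div_le_iff₀ (by positivity)]
  gcongr
  simp

/-- This uses the left continuity of `φ`: below `b_φ` it comes from convexity, at `b_φ` it is part
of the definition. -/
theorem map_rinv_le (v : ℝ≥0) : φ.toFun (φ.rinv v) ≤ v := by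
  set w := φ.rinv v with hw
  rcases eq_or_ne w 0 with h0 | h0
  · simp [h0, φ.map_zero]
  have hw0 : 0 < w := pos_iff_ne_zero.2 h0
  by_cases hfin : ∃ z, w < z ∧ φ.toFun z < ⊤
  · obtain ⟨z, hwz, hz⟩ := hfin
    have hz0 : 0 < z := hw0.trans hwz
    -- `w` is the convex combination of a point below `w` and of `z`, with weight `t` at `z`
    have key : ∀ t : ℝ≥0, 0 < t → t < w / z → φ.toFun w ≤ v + t * φ.toFun z := by
      intro t ht htw
      have htz : t * z < w := (lt_div_iff₀ hz0).1 htw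
      have ht1 : t < 1 := htw.trans ((div_lt_one hz0).2 hwz)
      have ht2 : 0 < 1 - t := tsub_pos_of_lt ht1
      have hu : (w - t * z) / (1 - t) < w := by
        rw [div_lt_iff₀ ht2, mul_tsub, mul_one]
        refine tsub_lt_tsub_left_of_le htz.le ?_
        rw [mul_comm]
        gcongr
      have hc := φ.convex.2 (mem_univ ((w - t * z) / (1 - t))) (mem_univ z) zero_le
        zero_le (tsub_add_cancel_of_le ht1.le)
      have e : (1 - t) • ((w - t * z) / (1 - t)) + t • z = w := by
        rw [smul_eq_mul, smul_eq_mul, mul_div_cancel₀ _ ht2.ne', tsub_add_cancel_of_le htz.le]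
      rw [e, ENNReal.smul_def, ENNReal.smul_def, smul_eq_mul, smul_eq_mul] at hc
      refine hc.trans ?_
      gcongr
      calc ((1 - t : ℝ≥0) : ℝ≥0∞) * φ.toFun ((w - t * z) / (1 - t)) ≤ 1 * v := by
            gcongr
            · exact_mod_cast tsub_le_self
            · exact φ.map_le_of_lt_rinv hu
        _ = v := one_mul _
    lift φ.toFun z to ℝ≥0 using hz.ne with a
    have hlim : Tendsto (fun t : ℝ≥0 => (v : ℝ≥0∞) + t * a) (𝓝[>] 0) (𝓝 (v + (0 : ℝ≥0) * a)) := by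
      have : Continuous fun t : ℝ≥0 => ((v + t * a : ℝ≥0) : ℝ≥0∞) := by fun_prop
      have := this.tendsto 0
      push_cast at this
      exact this.mono_left nhdsWithin_le_nhds
    have := ge_of_tendsto hlim (b := φ.toFun w) (by
      filter_upwards [Ioo_mem_nhdsGT (show (0 : ℝ≥0) < w / z by positivity)] with t ht
      exact key t ht.1 ht.2)
    simpa using this
  · push Not at hfin
    have hlub : IsLUB {u : ℝ≥0 | 0 < u ∧ φ.toFun u < ⊤} w := by
      refine ⟨fun u hu => not_lt.1 fun h => hu.2.not_ge (hfin u h), fun b hb => not_lt.1 fun h => ?_⟩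
      obtain ⟨c, hbc, hcw⟩ := exists_between h
      exact (hb ⟨zero_le.trans_lt hbc,
        (φ.map_le_of_lt_rinv hcw).trans_lt ENNReal.coe_lt_top⟩).not_gt hbc
    have : (𝓝[<] w).NeBot := nhdsLT_neBot_of_exists_lt ⟨0, hw0⟩
    exact le_of_tendsto (φ.leftCont w hlub) (eventually_mem_nhdsWithin.mono fun u hu =>
      φ.map_le_of_lt_rinv hu)

/-- The right continuity of the three inverses carries the inequality over to `0`. -/
theorem rinv_zero_le {φ φ₁ φ₂ : YoungFunction} {D u₀ : ℝ≥0} (h₀ : 0 < u₀)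
    (h : ∀ u : ℝ≥0, 0 < u → u ≤ u₀ → φ.rinv u ≤ D * φ₁.rinv u * φ₂.rinv u) :
    φ.rinv 0 ≤ D * φ₁.rinv 0 * φ₂.rinv 0 := by
  have key : ∀ s₁ > φ₁.rinv 0, ∀ s₂ > φ₂.rinv 0, φ.rinv 0 ≤ D * s₁ * s₂ := by
    intro s₁ h₁ s₂ h₂
    obtain ⟨u, hu, hu'⟩ := ENNReal.lt_iff_exists_nnreal_btwn.1
      (lt_min (lt_min (φ₁.lt_map_of_rinv_lt h₁) (φ₂.lt_map_of_rinv_lt h₂))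
        (ENNReal.coe_lt_coe.2 h₀))
    rw [lt_min_iff, lt_min_iff] at hu'
    calc φ.rinv 0 ≤ φ.rinv u := φ.rinv_mono zero_le
      _ ≤ D * φ₁.rinv u * φ₂.rinv u :=
        h u (by exact_mod_cast hu) (by exact_mod_cast hu'.2.le)
      _ ≤ D * s₁ * s₂ := by
        gcongr
        · exact φ₁.rinv_le_of_lt_map hu'.1.1
        · exact φ₂.rinv_le_of_lt_map hu'.1.2
  have key' : ∀ s₁ > φ₁.rinv 0, φ.rinv 0 ≤ D * s₁ * φ₂.rinv 0 := fun s₁ h₁ =>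
    ge_of_tendsto ((show Continuous fun s₂ : ℝ≥0 => D * s₁ * s₂ by fun_prop).continuousWithinAt
      (s := Ioi (φ₂.rinv 0))) (eventually_mem_nhdsWithin.mono fun s₂ h₂ => key s₁ h₁ s₂ h₂)
  exact ge_of_tendsto
    ((show Continuous fun s₁ : ℝ≥0 => D * s₁ * φ₂.rinv 0 by fun_prop).continuousWithinAt
      (s := Ioi (φ₁.rinv 0))) (eventually_mem_nhdsWithin.mono fun s₁ h₁ => key' s₁ h₁)

/-- If the inequality holds for small arguments, then it holds on every bounded interval, with
another constant. -/
theorem PrecSmall.exists_le {φ φ₁ φ₂ : YoungFunction} (h : φ.PrecSmall φ₁ φ₂) (c : ℝ≥0) :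
    ∃ D : ℝ≥0, 0 < D ∧ ∀ u ≤ c, φ.rinv u ≤ D * φ₁.rinv u * φ₂.rinv u := by
  obtain ⟨D, u₀, hD, h₀, H⟩ := h
  have p₁ := φ₁.rinv_pos h₀
  have p₂ := φ₂.rinv_pos h₀
  refine ⟨D + φ.rinv c / (φ₁.rinv u₀ * φ₂.rinv u₀), by positivity, fun u hu => ?_⟩
  rcases le_or_gt u u₀ with hu₀ | hu₀
  · calc φ.rinv u ≤ D * φ₁.rinv u * φ₂.rinv u := by
          rcases eq_or_ne u 0 with rfl | hu0
          · exact rinv_zero_le h₀ H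
          · exact H u (pos_iff_ne_zero.2 hu0) hu₀
      _ ≤ _ := by gcongr; simp
  · calc φ.rinv u ≤ φ.rinv c := φ.rinv_mono hu
      _ = φ.rinv c / (φ₁.rinv u₀ * φ₂.rinv u₀) * φ₁.rinv u₀ * φ₂.rinv u₀ := by
        rw [mul_assoc, div_mul_cancel₀ _ (by positivity)]
      _ ≤ _ := by
        gcongr
        · simp
        · exact φ₁.rinv_mono hu₀.le
        · exact φ₂.rinv_mono hu₀.le

end YoungFunction

namespace FnSpace

section General

variable {Ω : Type*} [MeasurableSpace Ω] {μ : Measure Ω} {E : FnSpace μ}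

/-! ### The modular and the Luxemburg–Nakano norm -/

theorem coeFn_compAbs (φ : YoungFunction) (x : Ω →ₘ[μ] ℝ) :
    ∀ᵐ t ∂μ, compAbs φ x t = (φ.toFun ‖x t‖₊).toReal :=
  AEEqFun.coeFn_compMeasurable _ φ.measurable_comp x

theorem modular_le (hE : E.IsBanachIdeal) (φ : YoungFunction) {x g : Ω →ₘ[μ] ℝ}
    (hg : g ∈ E.carrier) (h : ∀ᵐ t ∂μ, φ.toFun ‖x t‖₊ ≤ ENNReal.ofReal |g t|) :
    E.modular φ x ≤ ENNReal.ofReal (E.norm g) := by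
  have hfin : ∀ᵐ t ∂μ, φ.toFun ‖x t‖₊ < ⊤ := by
    filter_upwards [h] with t ht using ht.trans_lt ENNReal.ofReal_lt_top
  have hle : ∀ᵐ t ∂μ, |compAbs φ x t| ≤ |g t| := by
    filter_upwards [h, coeFn_compAbs φ x] with t ht hc
    rw [hc, abs_of_nonneg ENNReal.toReal_nonneg]
    exact ENNReal.toReal_le_of_le_ofReal (abs_nonneg _) ht
  obtain ⟨hmem, hn⟩ := hE.ideal g hg _ hle
  rw [modular, if_pos ⟨hfin, hmem⟩]
  exact ENNReal.ofReal_le_ofReal hn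

theorem of_modular_lt_top {φ : YoungFunction} {x : Ω →ₘ[μ] ℝ} (h : E.modular φ x < ⊤) :
    (∀ᵐ t ∂μ, φ.toFun ‖x t‖₊ = ENNReal.ofReal (compAbs φ x t)) ∧ compAbs φ x ∈ E.carrier ∧
      E.modular φ x = ENNReal.ofReal (E.norm (compAbs φ x)) := by
  by_cases hc : (∀ᵐ t ∂μ, φ.toFun ‖x t‖₊ < ⊤) ∧ compAbs φ x ∈ E.carrier
  · refine ⟨?_, hc.2, by rw [modular, if_pos hc]⟩
    filter_upwards [hc.1, coeFn_compAbs φ x] with t ht he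
    rw [he, ENNReal.ofReal_toReal ht.ne]
  · simp [modular, if_neg hc] at h

theorem of_modular_le_one {φ : YoungFunction} {x : Ω →ₘ[μ] ℝ} (h : E.modular φ x ≤ 1) :
    (∀ᵐ t ∂μ, φ.toFun ‖x t‖₊ = ENNReal.ofReal (compAbs φ x t)) ∧ compAbs φ x ∈ E.carrier ∧
      E.norm (compAbs φ x) ≤ 1 := by
  obtain ⟨h₁, h₂, h₃⟩ := of_modular_lt_top (h.trans_lt ENNReal.one_lt_top)
  refine ⟨h₁, h₂, ?_⟩
  rw [h₃] at h
  simpa using h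

theorem compAbs_nonneg (φ : YoungFunction) (x : Ω →ₘ[μ] ℝ) : ∀ᵐ t ∂μ, 0 ≤ compAbs φ x t := by
  filter_upwards [coeFn_compAbs φ x] with t ht
  rw [ht]
  exact ENNReal.toReal_nonneg

/-- Every element of `E_φ` has a multiple of modular at most `1`, so that the infimum which defines
its norm is taken over a nonempty set. -/
theorem exists_modular_le_one (hE : E.IsBanachIdeal) {φ : YoungFunction} {x : Ω →ₘ[μ] ℝ}
    (hx : x ∈ (E.calderon φ).carrier) : ∃ l : ℝ, 0 < l ∧ E.modular φ (l⁻¹ • x) ≤ 1 := by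
  obtain ⟨c, hc, hm⟩ := hx
  obtain ⟨hφ, hmem, -⟩ := of_modular_lt_top hm
  set g := compAbs φ (c • x)
  set k : ℝ≥0 := max 1 (E.norm g).toNNReal with hk
  have hk1 : 1 ≤ k := le_max_left _ _
  have hk0 : 0 < k := zero_lt_one.trans_le hk1
  have hgk : E.norm g ≤ k := (Real.le_coe_toNNReal _).trans (by exact_mod_cast le_max_right _ _)
  refine ⟨k / c, by positivity, ?_⟩
  have := modular_le hE φ (x := ((k : ℝ) / c)⁻¹ • x) (hE.smul_mem (k : ℝ)⁻¹ g hmem) (by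
    filter_upwards [hφ, AEEqFun.coeFn_smul ((k : ℝ) / c)⁻¹ x, AEEqFun.coeFn_smul c x,
      AEEqFun.coeFn_smul (k : ℝ)⁻¹ g, compAbs_nonneg φ (c • x)] with t h₁ h₂ h₃ h₄ h₅
    have e : ‖(((k : ℝ) / c)⁻¹ • x : Ω →ₘ[μ] ℝ) t‖₊ = k⁻¹ * ‖(c • x : Ω →ₘ[μ] ℝ) t‖₊ := by
      rw [h₂, h₃]
      apply NNReal.eq
      simp [abs_of_pos hc]
      field_simp
    rw [e, h₄]
    refine (φ.map_mul_le (inv_le_one_of_one_le₀ hk1) _).trans (le_of_eq ?_)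
    rw [h₁, Pi.smul_apply, smul_eq_mul, abs_of_nonneg (mul_nonneg (by positivity) h₅),
      ENNReal.ofReal_mul (by positivity)]
    congr 1
    rw [← NNReal.coe_inv, ENNReal.ofReal_coe_nnreal])
  refine this.trans ?_
  rw [hE.norm_smul _ _ hmem, ENNReal.ofReal_le_one, abs_of_nonneg (by positivity),
    inv_mul_le_iff₀ (by positivity), mul_one]
  exact hgk

theorem exists_lt_of_calderon_norm_lt (hE : E.IsBanachIdeal) {φ : YoungFunction}
    {x : Ω →ₘ[μ] ℝ} (hx : x ∈ (E.calderon φ).carrier) {r : ℝ} (hr : (E.calderon φ).norm x < r) :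
    ∃ l : ℝ, 0 < l ∧ l < r ∧ E.modular φ (l⁻¹ • x) ≤ 1 := by
  obtain ⟨l, hl, hlr⟩ := exists_lt_of_csInf_lt (exists_modular_le_one hE hx) hr
  exact ⟨l, hl.1, hlr, hl.2⟩

theorem calderon_norm_nonneg (φ : YoungFunction) (x : Ω →ₘ[μ] ℝ) : 0 ≤ (E.calderon φ).norm x :=
  Real.sInf_nonneg fun _ hl => hl.1.le

theorem mem_calderon_and_norm_le {φ : YoungFunction} {x : Ω →ₘ[μ] ℝ} {l : ℝ} (hl : 0 < l)
    (h : E.modular φ (l⁻¹ • x) ≤ 1) :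
    x ∈ (E.calderon φ).carrier ∧ (E.calderon φ).norm x ≤ l :=
  ⟨⟨l⁻¹, inv_pos.2 hl, h.trans_lt ENNReal.one_lt_top⟩,
    csInf_le ⟨0, fun _ hr => hr.1.le⟩ ⟨hl, h⟩⟩

theorem prod_norm_le {φ₁ φ₂ : YoungFunction} {x y : Ω →ₘ[μ] ℝ}
    (hx : x ∈ (E.calderon φ₁).carrier) (hy : y ∈ (E.calderon φ₂).carrier) :
    ((E.calderon φ₁).prod (E.calderon φ₂)).norm (x * y) ≤
      (E.calderon φ₁).norm x * (E.calderon φ₂).norm y := by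
  refine csInf_le ⟨0, ?_⟩ ⟨x, hx, y, hy, rfl, rfl⟩
  rintro r ⟨x, -, y, -, -, rfl⟩
  exact mul_nonneg (calderon_norm_nonneg _ _) (calderon_norm_nonneg _ _)

/-! ### Sufficiency: factoring `x` through `φ₁⁻¹(g)` and `φ₂⁻¹(g)` -/

theorem exists_rinv_comp (ψ : YoungFunction) (g : Ω →ₘ[μ] ℝ) (K : ℝ≥0) :
    ∃ w : Ω →ₘ[μ] ℝ, ∀ᵐ t ∂μ, w t = (ψ.rinv ‖g t‖₊ / K : ℝ≥0) := by
  have hm : Measurable fun s : ℝ => ((ψ.rinv ‖s‖₊ / K : ℝ≥0) : ℝ) :=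
    ((ψ.rinv_mono.measurable.comp measurable_nnnorm).div_const K).coe_nnreal_real
  exact ⟨g.compMeasurable _ hm, AEEqFun.coeFn_compMeasurable _ hm g⟩

theorem modular_rinv_comp_le (hE : E.IsBanachIdeal) (ψ : YoungFunction) {w g : Ω →ₘ[μ] ℝ}
    {K : ℝ≥0} (hK : 1 ≤ K) (hg : g ∈ E.carrier) (hgK : E.norm g ≤ K)
    (hw : ∀ᵐ t ∂μ, ‖w t‖₊ ≤ ψ.rinv ‖g t‖₊ / K) : E.modular ψ w ≤ 1 := by
  have hK0 : 0 < K := zero_lt_one.trans_le hK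
  have := modular_le hE ψ (x := w) (hE.smul_mem (K : ℝ)⁻¹ g hg) (by
    filter_upwards [hw, AEEqFun.coeFn_smul (K : ℝ)⁻¹ g] with t h₁ h₂
    rw [h₂]
    calc ψ.toFun ‖w t‖₊ ≤ ψ.toFun (K⁻¹ * ψ.rinv ‖g t‖₊) := by
          refine ψ.mono (h₁.trans_eq ?_)
          rw [div_eq_inv_mul]
      _ ≤ (K⁻¹ : ℝ≥0) * ψ.toFun (ψ.rinv ‖g t‖₊) :=
          ψ.map_mul_le (inv_le_one_of_one_le₀ hK) _
      _ ≤ (K⁻¹ : ℝ≥0) * (‖g t‖₊ : ℝ≥0) := by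
          gcongr
          exact ψ.map_rinv_le _
      _ = _ := by
          rw [← ENNReal.coe_mul, ← ENNReal.ofReal_coe_nnreal]
          congr 1
          simp [abs_mul])
  refine this.trans ?_
  rw [hE.norm_smul _ _ hg, ENNReal.ofReal_le_one, abs_of_nonneg (by positivity),
    inv_mul_le_iff₀ (by positivity), mul_one]
  exact hgK

/-- The common form of the three sufficient conditions: `φ(|x|)` has a majorant `g` in `E`, with a
uniform bound `K` on its norm, whose values lie where the inequality between the inverses holds.
Then `|x| ≤ φ⁻¹(g) ≤ D φ₁⁻¹(g) φ₂⁻¹(g)`. -/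
theorem embeds_prod_of_majorant (hE : E.IsBanachIdeal) {φ φ₁ φ₂ : YoungFunction} {D K : ℝ≥0}
    (hD : 0 < D) (hK : 1 ≤ K)
    (H : ∀ x : Ω →ₘ[μ] ℝ, E.modular φ x ≤ 1 → ∃ g ∈ E.carrier, E.norm g ≤ K ∧
      ∀ᵐ t ∂μ, φ.toFun ‖x t‖₊ ≤ (‖g t‖₊ : ℝ≥0) ∧
        φ.rinv ‖g t‖₊ ≤ D * φ₁.rinv ‖g t‖₊ * φ₂.rinv ‖g t‖₊) :
    (E.calderon φ).Embeds ((E.calderon φ₁).prod (E.calderon φ₂)) := by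
  have hK0 : 0 < K := zero_lt_one.trans_le hK
  have hC : 0 < D * K * K := by positivity
  have main : ∀ x : Ω →ₘ[μ] ℝ, ∀ l : ℝ, 0 < l → E.modular φ (l⁻¹ • x) ≤ 1 →
      x ∈ ((E.calderon φ₁).prod (E.calderon φ₂)).carrier ∧
      ((E.calderon φ₁).prod (E.calderon φ₂)).norm x ≤ l * (D * K * K : ℝ≥0) := by
    intro x l hl hm
    obtain ⟨g, hg, hgK, hae⟩ := H _ hm
    obtain ⟨w, hw⟩ := exists_rinv_comp φ₂ g K
    set r : ℝ := l * (D * K * K : ℝ≥0) with hr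
    have hr0 : 0 < r := by positivity
    obtain ⟨y, hy⟩ : ∃ y : Ω →ₘ[μ] ℝ, ∀ᵐ t ∂μ, y t = x t / w t :=
      ⟨AEEqFun.mk (fun t => x t / w t) (x.aestronglyMeasurable.aemeasurable.div
        w.aestronglyMeasurable.aemeasurable).aestronglyMeasurable, AEEqFun.coeFn_mk _ _⟩
    have hbound : ∀ᵐ t ∂μ, ‖x t‖₊ ≤
        l.toNNReal * (D * φ₁.rinv ‖g t‖₊ * φ₂.rinv ‖g t‖₊) := by
      filter_upwards [hae, AEEqFun.coeFn_smul l⁻¹ x] with t ht hs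
      have h₁ := (φ.le_rinv_of_map_le ht.1).trans ht.2
      have h₂ : ‖x t‖₊ = l.toNNReal * ‖(l⁻¹ • x : Ω →ₘ[μ] ℝ) t‖₊ := by
        rw [hs]
        apply NNReal.eq
        simp [abs_of_pos hl, hl.le, hl.ne']
      rw [h₂]
      gcongr
    have hxy : x = y * w := by
      refine AEEqFun.ext ?_
      filter_upwards [hbound, hw, hy, AEEqFun.coeFn_mul y w] with t h₁ h₂ h₃ h₄
      rw [h₄, Pi.mul_apply, h₃]
      by_cases h0 : w t = 0
      -- the bound forces `x t = 0` here, in accordance with `x t / 0 = 0`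
      · have : φ₂.rinv ‖g t‖₊ = 0 := by
          rw [h0] at h₂
          have h₂' : φ₂.rinv ‖g t‖₊ / K = 0 := by exact_mod_cast h₂.symm
          simpa [hK0.ne'] using h₂'
        rw [this] at h₁
        have hx0 : x t = 0 := by simpa using h₁
        simp [hx0]
      · rw [div_mul_cancel₀ _ h0]
    have hy' := mem_calderon_and_norm_le (E := E) (φ := φ₁) (x := y) hr0
      (modular_rinv_comp_le hE φ₁ hK hg hgK (by
        filter_upwards [hbound, hw, hy, AEEqFun.coeFn_smul r⁻¹ y] with t h₁ h₂ h₃ h₄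
        rw [h₄, Pi.smul_apply, h₃, nnnorm_smul, nnnorm_div, h₂]
        have e : ‖r⁻¹‖₊ = (l.toNNReal * (D * K * K))⁻¹ := by
          apply NNReal.eq
          rw [hr]
          simp [abs_of_pos hl, hl.le]
        have hl' : 0 < l.toNNReal := Real.toNNReal_pos.2 hl
        rw [e, NNReal.nnnorm_eq]
        rcases eq_or_ne (φ₂.rinv ‖g t‖₊) 0 with h0 | h0
        · simp [h0]
        · have h0' : 0 < φ₂.rinv ‖g t‖₊ := pos_iff_ne_zero.2 h0
          rw [inv_mul_le_iff₀ (by positivity), div_le_iff₀ (by positivity)]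
          refine h₁.trans (le_of_eq ?_)
          field_simp))
    have hw' := mem_calderon_and_norm_le (E := E) (φ := φ₂) (x := w) one_pos (by
      rw [inv_one, one_smul]
      refine modular_rinv_comp_le hE φ₂ hK hg hgK ?_
      filter_upwards [hw] with t ht
      rw [ht, NNReal.nnnorm_eq])
    refine ⟨⟨y, hy'.1, w, hw'.1, hxy⟩, ?_⟩
    calc _ ≤ (E.calderon φ₁).norm y * (E.calderon φ₂).norm w := by
          rw [hxy]
          exact prod_norm_le hy'.1 hw'.1
      _ ≤ r * 1 := mul_le_mul hy'.2 hw'.2 (calderon_norm_nonneg _ _) hr0.le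
      _ = _ := mul_one _
  refine ⟨(D * K * K : ℝ≥0), by positivity, fun x hx => ?_⟩
  obtain ⟨l, hl, hm⟩ := exists_modular_le_one hE hx
  refine ⟨(main x l hl hm).1, ?_⟩
  rw [← div_le_iff₀' (by positivity)]
  refine le_csInf ⟨l, hl, hm⟩ fun r hr => ?_
  rw [div_le_iff₀ (by positivity)]
  exact (main x r hr.1 hr.2).2

theorem embeds_prod_of_precAll (hE : E.IsBanachIdeal) {φ φ₁ φ₂ : YoungFunction}
    (h : φ.PrecAll φ₁ φ₂) :
    (E.calderon φ).Embeds ((E.calderon φ₁).prod (E.calderon φ₂)) := by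
  obtain ⟨D, hD, H⟩ := h
  refine embeds_prod_of_majorant hE hD le_rfl fun x hx => ?_
  obtain ⟨h₁, h₂, h₃⟩ := of_modular_le_one hx
  refine ⟨_, h₂, by simpa using h₃, ?_⟩
  filter_upwards [h₁] with t ht
  refine ⟨ht.le.trans (Real.ofReal_le_enorm _), ?_⟩
  rcases eq_or_ne ‖compAbs φ x t‖₊ 0 with h0 | h0
  · rw [h0]
    exact YoungFunction.rinv_zero_le one_pos fun u hu _ => H u hu
  · exact H _ (pos_iff_ne_zero.2 h0)

theorem embeds_prod_of_precSmall (hE : E.IsBanachIdeal) {φ φ₁ φ₂ : YoungFunction}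
    (h : φ.PrecSmall φ₁ φ₂) (hL : E.Embeds (Linfty μ)) :
    (E.calderon φ).Embeds ((E.calderon φ₁).prod (E.calderon φ₂)) := by
  obtain ⟨C, hC, hL⟩ := hL
  obtain ⟨D, hD, H⟩ := h.exists_le C.toNNReal
  refine embeds_prod_of_majorant hE hD le_rfl fun x hx => ?_
  obtain ⟨h₁, h₂, h₃⟩ := of_modular_le_one hx
  refine ⟨_, h₂, by simpa using h₃, ?_⟩
  obtain ⟨h₄, h₅⟩ := hL _ h₂
  have h₆ : eLpNorm (compAbs φ x) ⊤ μ ≤ ENNReal.ofReal C := by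
    rw [← ENNReal.ofReal_toReal (ne_of_lt h₄)]
    exact ENNReal.ofReal_le_ofReal (h₅.trans (mul_le_of_le_one_right hC.le h₃))
  rw [eLpNorm_exponent_top] at h₆
  filter_upwards [h₁, enorm_ae_le_eLpNormEssSup (compAbs φ x) μ] with t ht ht'
  exact ⟨ht.le.trans (Real.ofReal_le_enorm _),
    H _ (ENNReal.coe_le_coe.1 (ht'.trans h₆))⟩

theorem one_mem_of_linfty_embeds (hL : (Linfty μ).Embeds E) : (1 : Ω →ₘ[μ] ℝ) ∈ E.carrier := by
  obtain ⟨C, -, hL⟩ := hL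
  refine (hL 1 ?_).1
  have : eLpNorm (1 : Ω →ₘ[μ] ℝ) ⊤ μ ≤ 1 := by
    rw [eLpNorm_exponent_top]
    refine essSup_le_of_ae_le _ ?_
    filter_upwards [AEEqFun.coeFn_one (α := Ω) (μ := μ) (β := ℝ)] with t ht
    simp [ht]
  exact this.trans_lt ENNReal.one_lt_top

theorem linfty_embeds_of_one_mem (hE : E.IsBanachIdeal) (h1 : (1 : Ω →ₘ[μ] ℝ) ∈ E.carrier) :
    (Linfty μ).Embeds E := by
  have hn := hE.norm_nonneg 1 h1
  refine ⟨E.norm 1 + 1, by positivity, fun x hx => ?_⟩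
  set b := (eLpNorm x ⊤ μ).toReal with hb
  have hb0 : 0 ≤ b := ENNReal.toReal_nonneg
  obtain ⟨h₁, h₂⟩ := hE.ideal _ (hE.smul_mem b 1 h1) x (by
    filter_upwards [enorm_ae_le_eLpNormEssSup x μ, AEEqFun.coeFn_smul b (1 : Ω →ₘ[μ] ℝ),
      AEEqFun.coeFn_one (α := Ω) (μ := μ) (β := ℝ)] with t h₁ h₂ h₃
    rw [← eLpNorm_exponent_top] at h₁
    have := ENNReal.toReal_mono (ne_of_lt hx) h₁
    rw [toReal_enorm, Real.norm_eq_abs] at this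
    have e : (b • (1 : Ω →ₘ[μ] ℝ)) t = b := by simp [h₂, h₃]
    rwa [e, abs_of_nonneg hb0])
  refine ⟨h₁, h₂.trans ?_⟩
  rw [hE.norm_smul _ _ h1, abs_of_nonneg hb0, mul_comm]
  exact mul_le_mul_of_nonneg_right (by linarith) hb0

theorem embeds_prod_of_precLarge (hE : E.IsBanachIdeal) {φ φ₁ φ₂ : YoungFunction}
    (h : φ.PrecLarge φ₁ φ₂) (hL : (Linfty μ).Embeds E) :
    (E.calderon φ).Embeds ((E.calderon φ₁).prod (E.calderon φ₂)) := by
  obtain ⟨D, u₀, hD, h₀, H⟩ := h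
  have h1 := one_mem_of_linfty_embeds hL
  have h1n := hE.norm_nonneg _ h1
  refine embeds_prod_of_majorant hE hD
    (K := 1 + u₀ * (E.norm 1).toNNReal) (by simp) fun x hx => ?_
  obtain ⟨h₁, h₂, h₃⟩ := of_modular_le_one hx
  refine ⟨compAbs φ x + (u₀ : ℝ) • 1, hE.add_mem _ h₂ _ (hE.smul_mem _ _ h1), ?_, ?_⟩
  · refine (hE.norm_add_le _ h₂ _ (hE.smul_mem _ _ h1)).trans ?_
    rw [hE.norm_smul _ _ h1]
    simp only [NNReal.abs_eq, NNReal.coe_add, NNReal.coe_one, NNReal.coe_mul,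
      Real.coe_toNNReal _ h1n]
    linarith
  · filter_upwards [h₁, compAbs_nonneg φ x, AEEqFun.coeFn_add (compAbs φ x) ((u₀ : ℝ) • 1),
      AEEqFun.coeFn_smul (u₀ : ℝ) (1 : Ω →ₘ[μ] ℝ),
      AEEqFun.coeFn_one (α := Ω) (μ := μ) (β := ℝ)] with t ht h0 hadd hs hone
    have e : (compAbs φ x + (u₀ : ℝ) • 1 : Ω →ₘ[μ] ℝ) t = compAbs φ x t + u₀ := by
      simp [hadd, hs, hone]
    have hle : u₀ ≤ ‖(compAbs φ x + (u₀ : ℝ) • 1 : Ω →ₘ[μ] ℝ) t‖₊ := by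
      rw [e, ← NNReal.coe_le_coe, coe_nnnorm, Real.norm_eq_abs, abs_of_nonneg (by positivity)]
      linarith
    refine ⟨?_, H _ hle⟩
    rw [ht, e, ← ENNReal.ofReal_coe_nnreal, coe_nnnorm, Real.norm_eq_abs,
      abs_of_nonneg (by positivity)]
    exact ENNReal.ofReal_le_ofReal (by simp)

/-! ### Necessity: testing the embedding on characteristic functions -/

theorem coeFn_chi {B : Set Ω} (hB : MeasurableSet B) :
    ∀ᵐ t ∂μ, chi μ B hB t = B.indicator (fun _ => (1 : ℝ)) t :=
  AEEqFun.coeFn_mk _ _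

theorem chi_mem_and_norm_le_of_subset (hE : E.IsBanachIdeal) {A B : Set Ω}
    (hA : MeasurableSet A) (hB : MeasurableSet B) (hBA : B ⊆ A) (hmem : chi μ A hA ∈ E.carrier) :
    chi μ B hB ∈ E.carrier ∧ E.norm (chi μ B hB) ≤ E.norm (chi μ A hA) := by
  refine hE.ideal _ hmem _ ?_
  filter_upwards [coeFn_chi hA, coeFn_chi hB] with t h₁ h₂
  rw [h₁, h₂]
  by_cases h : t ∈ B
  · simp [h, hBA h]
  · simp [h]

theorem chi_union_mem_and_norm_le (hE : E.IsBanachIdeal) {A B S : Set Ω}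
    (hA : MeasurableSet A) (hB : MeasurableSet B) (hS : MeasurableSet S) (hSAB : S ⊆ A ∪ B)
    (hmA : chi μ A hA ∈ E.carrier) (hmB : chi μ B hB ∈ E.carrier) :
    chi μ S hS ∈ E.carrier ∧
      E.norm (chi μ S hS) ≤ E.norm (chi μ A hA) + E.norm (chi μ B hB) := by
  have h := hE.ideal _ (hE.add_mem _ hmA _ hmB) (chi μ S hS) (by
    filter_upwards [coeFn_chi hA, coeFn_chi hB, coeFn_chi hS,
      AEEqFun.coeFn_add (chi μ A hA) (chi μ B hB)] with t h₁ h₂ h₃ h₄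
    rw [h₃, h₄, Pi.add_apply, h₁, h₂]
    by_cases h : t ∈ S
    · rcases hSAB h with h' | h' <;> by_cases hA' : t ∈ A <;> by_cases hB' : t ∈ B <;>
        simp_all <;> norm_num
    · simp [h])
  exact ⟨h.1, h.2.trans (hE.norm_add_le _ hmA _ hmB)⟩

theorem chi_norm_pos (hE : E.IsBanachIdeal) {A : Set Ω} (hA : MeasurableSet A)
    (hmem : chi μ A hA ∈ E.carrier) (hμ : 0 < μ A) : 0 < E.norm (chi μ A hA) := by
  refine (hE.norm_nonneg _ hmem).lt_of_ne fun h => hμ.ne' ?_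
  have h0 := hE.norm_eq_zero _ hmem h.symm
  have hae := coeFn_chi (μ := μ) hA
  rw [h0] at hae
  refine measure_mono_null (fun t ht => ?_)
    (ae_iff.1 (hae.and (AEEqFun.coeFn_zero (μ := μ) (β := ℝ))))
  simp only [mem_ofPred_eq]
  rintro ⟨h₁, h₂⟩
  rw [h₂] at h₁
  simp [ht] at h₁

/-- A set whose characteristic function can be used to test an embedding between
Calderón–Lozanovskiĭ spaces: it has positive norm in `E`, and this norm is at most doubled in
comparison with any subset of at least half the measure. -/
structure IsTestSet (E : FnSpace μ) (A : Set Ω) : Prop where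
  meas : MeasurableSet A
  mem : chi μ A meas ∈ E.carrier
  norm_pos : 0 < E.norm (chi μ A meas)
  half : ∀ (B : Set Ω) (hB : MeasurableSet B), B ⊆ A → μ A ≤ 2 * μ B →
    E.norm (chi μ A meas) ≤ 2 * E.norm (chi μ B hB)

theorem map_le_of_le_on (hE : E.IsBanachIdeal) {ψ : YoungFunction} {y : Ω →ₘ[μ] ℝ}
    (hy : E.modular ψ y ≤ 1) {B : Set Ω} (hB : MeasurableSet B) (hmem : chi μ B hB ∈ E.carrier)
    {s v : ℝ≥0} (hs : ∀ t ∈ B, s ≤ ‖y t‖₊) (hv : 1 ≤ v * E.norm (chi μ B hB)) :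
    ψ.toFun s ≤ v := by
  obtain ⟨h₁, h₂, h₃⟩ := of_modular_le_one hy
  refine ENNReal.le_of_forall_nnreal_lt fun m hm => ?_
  have h := (hE.ideal _ h₂ ((m : ℝ) • chi μ B hB) (by
    filter_upwards [h₁, coeFn_chi hB, AEEqFun.coeFn_smul (m : ℝ) (chi μ B hB)] with t h₁ h₂ h₃
    rw [h₃, Pi.smul_apply, h₂]
    by_cases ht : t ∈ B
    · have := hm.le.trans ((ψ.mono (hs t ht)).trans_eq h₁)
      rw [← ENNReal.ofReal_coe_nnreal] at this
      rcases eq_or_ne m 0 with rfl | h0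
      · simp
      · have hpos : 0 < compAbs ψ y t := by
          by_contra hneg
          rw [ENNReal.ofReal_of_nonpos (not_lt.1 hneg)] at this
          simp [h0] at this
        have h4 := (ENNReal.ofReal_le_ofReal_iff hpos.le).1 this
        simpa [ht] using h4.trans (le_abs_self _)
    · simp [ht])).2
  rw [hE.norm_smul _ _ hmem, NNReal.abs_eq] at h
  have h5 : (m : ℝ) * E.norm (chi μ B hB) ≤ v * E.norm (chi μ B hB) := (h.trans h₃).trans hv
  have hpos : 0 < E.norm (chi μ B hB) := by
    refine (hE.norm_nonneg _ hmem).lt_of_ne fun h0 => ?_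
    rw [← h0, mul_zero] at hv
    exact not_le.2 one_pos hv
  exact_mod_cast le_of_mul_le_mul_right h5 hpos

/-- If `|y z| = c` on a test set `A` and both factors have modular at most `1`, then on at least
half of `A` either `|y| ≥ s` or `|z| ≥ c / s`. For `s > 4 φ₁⁻¹(u)`, where `1 / u` is the norm of
`χ_A` up to a factor `2`, the modular of `y` excludes the first case. -/
theorem IsTestSet.le_rinv_mul_rinv (hE : E.IsBanachIdeal) {φ₁ φ₂ : YoungFunction} {A : Set Ω}
    (hA : E.IsTestSet A) {u c : ℝ≥0} (hu : 1 ≤ 2 * u * E.norm (chi μ A hA.meas))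
    {y z : Ω →ₘ[μ] ℝ} (hy : E.modular φ₁ y ≤ 1) (hz : E.modular φ₂ z ≤ 1)
    (hyz : ∀ᵐ t ∂μ, t ∈ A → ‖y t‖₊ * ‖z t‖₊ = c) :
    c ≤ 16 * (φ₁.rinv u * φ₂.rinv u) := by
  have large : ∀ {ψ : YoungFunction} {w : Ω →ₘ[μ] ℝ} {s : ℝ≥0}, E.modular ψ w ≤ 1 →
      μ A ≤ 2 * μ (A ∩ {t | s ≤ ‖w t‖₊}) → s ≤ 4 * ψ.rinv u := by
    intro ψ w s hw hμ
    have hm : MeasurableSet (A ∩ {t | s ≤ ‖w t‖₊}) :=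
      hA.meas.inter (measurableSet_le measurable_const w.measurable.nnnorm)
    have h₁ := hA.half _ hm inter_subset_left hμ
    refine (ψ.le_rinv_of_map_le ?_).trans (ψ.rinv_mul_le (by norm_num) u)
    refine map_le_of_le_on hE hw hm
      (chi_mem_and_norm_le_of_subset hE hA.meas hm inter_subset_left hA.mem).1
      (fun t ht => ht.2) ?_
    have := mul_le_mul_of_nonneg_left h₁ (show (0 : ℝ) ≤ 2 * u by positivity)
    push_cast
    linarith
  have key : ∀ s > 4 * φ₁.rinv u, c ≤ s * (4 * φ₂.rinv u) := by
    intro s hs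
    have hs0 : 0 < s := zero_le.trans_lt hs
    rw [← div_le_iff₀' hs0]
    have hcov : μ A ≤ μ (A ∩ {t | s ≤ ‖y t‖₊}) + μ (A ∩ {t | c / s ≤ ‖z t‖₊}) := by
      refine le_trans (measure_mono_ae ?_) (measure_union_le _ _)
      filter_upwards [hyz] with t ht hAt
      by_contra hcon
      change ¬ (t ∈ A ∩ _ ∪ A ∩ _) at hcon
      simp only [mem_union, mem_inter_iff, mem_ofPred_eq, not_or, not_and, not_le] at hcon
      have h₁ := hcon.1 hAt
      have h₂ := (lt_div_iff₀' hs0).1 (hcon.2 hAt)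
      exact (ht hAt).not_lt (lt_of_le_of_lt (mul_le_mul_left h₁.le _) h₂)
    by_contra hcon
    have h₁ : 2 * μ (A ∩ {t | s ≤ ‖y t‖₊}) < μ A :=
      not_le.1 fun h => hs.not_ge (large hy h)
    have h₂ : 2 * μ (A ∩ {t | c / s ≤ ‖z t‖₊}) < μ A :=
      not_le.1 fun h => hcon (large hz h)
    have h₃ := ENNReal.add_lt_add h₁ h₂
    rw [← mul_add, ← two_mul] at h₃
    exact h₃.not_ge (by gcongr)
  have := ge_of_tendsto (b := c) (x := 𝓝[>] (4 * φ₁.rinv u))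
    ((show Continuous fun s : ℝ≥0 => s * (4 * φ₂.rinv u) by fun_prop).continuousWithinAt
      (s := Ioi (4 * φ₁.rinv u))) (eventually_mem_nhdsWithin.mono key)
  refine this.trans_eq ?_
  ring

theorem modular_rinv_smul_chi_le (hE : E.IsBanachIdeal) (φ : YoungFunction) {A : Set Ω}
    (hA : MeasurableSet A) (hmem : chi μ A hA ∈ E.carrier) {u : ℝ≥0}
    (hu : u * E.norm (chi μ A hA) ≤ 1) :
    E.modular φ ((φ.rinv u : ℝ) • chi μ A hA) ≤ 1 := by
  refine (modular_le hE φ (hE.smul_mem (u : ℝ) _ hmem) ?_).trans ?_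
  · filter_upwards [coeFn_chi hA, AEEqFun.coeFn_smul (φ.rinv u : ℝ) (chi μ A hA),
      AEEqFun.coeFn_smul (u : ℝ) (chi μ A hA)] with t h₁ h₂ h₃
    rw [h₂, h₃, Pi.smul_apply, Pi.smul_apply, h₁]
    by_cases ht : t ∈ A
    · simpa [ht] using φ.map_rinv_le u
    · simp [ht, φ.map_zero]
  · rw [hE.norm_smul _ _ hmem, NNReal.abs_eq]
    exact ENNReal.ofReal_le_one.2 hu

/-- The embedding, applied to `φ⁻¹(u) χ_A`. -/
theorem IsTestSet.rinv_le_of_embeds (hE : E.IsBanachIdeal) {φ φ₁ φ₂ : YoungFunction} {C : ℝ}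
    (hemb : ∀ x ∈ (E.calderon φ).carrier, x ∈ ((E.calderon φ₁).prod (E.calderon φ₂)).carrier ∧
      ((E.calderon φ₁).prod (E.calderon φ₂)).norm x ≤ C * (E.calderon φ).norm x)
    (hC : 0 < C) {A : Set Ω} (hA : E.IsTestSet A) {u : ℝ≥0}
    (hu : u * E.norm (chi μ A hA.meas) ≤ 1) (hu' : 1 ≤ 2 * u * E.norm (chi μ A hA.meas)) :
    φ.rinv u ≤ (16 * (C + 1).toNNReal) * φ₁.rinv u * φ₂.rinv u := by
  set x := (φ.rinv u : ℝ) • chi μ A hA.meas with hx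
  obtain ⟨hx₁, hx₂⟩ := mem_calderon_and_norm_le (E := E) (φ := φ) (x := x) one_pos (by
    rw [inv_one, one_smul]
    exact modular_rinv_smul_chi_le hE φ hA.meas hA.mem hu)
  obtain ⟨⟨y₀, hy₀, z₀, hz₀, h₀⟩, hn⟩ := hemb x hx₁
  have hn' : ((E.calderon φ₁).prod (E.calderon φ₂)).norm x < C + 1 := by nlinarith
  obtain ⟨_, ⟨y, hy, z, hz, hxyz, rfl⟩, hr⟩ :=
    exists_lt_of_csInf_lt (by exact ⟨_, y₀, hy₀, z₀, hz₀, h₀, rfl⟩) hn'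
  -- the infima in the norms of `y` and `z` need not be attained, hence the room `ε`
  obtain ⟨ε, hε, hε0⟩ : ∃ ε : ℝ,
      ((E.calderon φ₁).norm y + ε) * ((E.calderon φ₂).norm z + ε) < C + 1 ∧ 0 < ε := by
    have hc : Tendsto (fun ε : ℝ => ((E.calderon φ₁).norm y + ε) * ((E.calderon φ₂).norm z + ε))
        (𝓝[>] 0) (𝓝 (((E.calderon φ₁).norm y + 0) * ((E.calderon φ₂).norm z + 0))) :=
      (show Continuous fun ε : ℝ => ((E.calderon φ₁).norm y + ε) * ((E.calderon φ₂).norm z + ε)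
        by fun_prop).continuousWithinAt
    rw [add_zero, add_zero] at hc
    exact ((hc.eventually_lt_const hr).and eventually_mem_nhdsWithin).exists
  obtain ⟨l, hl0, hl, hly⟩ := exists_lt_of_calderon_norm_lt hE hy (lt_add_of_pos_right _ hε0)
  obtain ⟨m, hm0, hm, hmz⟩ := exists_lt_of_calderon_norm_lt hE hz (lt_add_of_pos_right _ hε0)
  have hlm : l * m ≤ C + 1 :=
    (mul_le_mul hl.le hm.le hm0.le (hl0.le.trans hl.le)).trans hε.le
  lift l to ℝ≥0 using hl0.le
  lift m to ℝ≥0 using hm0.le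
  have hl0' : 0 < l := by exact_mod_cast hl0
  have hm0' : 0 < m := by exact_mod_cast hm0
  have hmain := hA.le_rinv_mul_rinv hE (c := φ.rinv u / (l * m)) hu' hly hmz (by
    have hx' : ∀ᵐ t ∂μ, x t = (y * z : Ω →ₘ[μ] ℝ) t := by rw [hxyz]; simp
    filter_upwards [AEEqFun.coeFn_smul (l : ℝ)⁻¹ y, AEEqFun.coeFn_smul (m : ℝ)⁻¹ z,
      AEEqFun.coeFn_mul y z, AEEqFun.coeFn_smul (φ.rinv u : ℝ) (chi μ A hA.meas),
      coeFn_chi hA.meas, hx'] with t h₁ h₂ h₃ h₄ h₅ h₆ ht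
    rw [hx, h₃, h₄, Pi.smul_apply, h₅, Pi.mul_apply] at h₆
    have h₇ : φ.rinv u = ‖y t‖₊ * ‖z t‖₊ := by
      rw [← nnnorm_mul, ← h₆]
      simp [ht]
    rw [h₁, h₂, h₇, Pi.smul_apply, Pi.smul_apply, nnnorm_smul, nnnorm_smul, nnnorm_inv, nnnorm_inv,
      NNReal.nnnorm_eq, NNReal.nnnorm_eq]
    field_simp)
  rw [div_le_iff₀ (by positivity)] at hmain
  have hlm' : l * m ≤ (C + 1).toNNReal := by
    rw [← NNReal.coe_le_coe, Real.coe_toNNReal _ (by positivity)]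
    exact_mod_cast hlm
  calc φ.rinv u ≤ 16 * (φ₁.rinv u * φ₂.rinv u) * (l * m) := hmain
    _ ≤ 16 * (φ₁.rinv u * φ₂.rinv u) * (C + 1).toNNReal := by gcongr
    _ = _ := by ring

/-- Test sets whose norms decrease to `0`, at most halving in each step, reach all large `u`. -/
theorem precLarge_of_testSets (hE : E.IsBanachIdeal) {φ φ₁ φ₂ : YoungFunction}
    (hemb : (E.calderon φ).Embeds ((E.calderon φ₁).prod (E.calderon φ₂)))
    {A : ℕ → Set Ω} (hA : ∀ k, E.IsTestSet (A k))
    (hstep : ∀ k, E.norm (chi μ (A k) (hA k).meas) ≤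
      2 * E.norm (chi μ (A (k + 1)) (hA (k + 1)).meas))
    (hlim : Tendsto (fun k => E.norm (chi μ (A k) (hA k).meas)) atTop (𝓝 0)) :
    φ.PrecLarge φ₁ φ₂ := by
  obtain ⟨C, hC, hemb⟩ := hemb
  set f : ℕ → ℝ := fun k => E.norm (chi μ (A k) (hA k).meas) with hf
  have hf0 : ∀ k, 0 < f k := fun k => (hA k).norm_pos
  refine ⟨16 * (C + 1).toNNReal, (f 0)⁻¹.toNNReal, ?_, ?_, fun u hu => ?_⟩
  · exact mul_pos (by norm_num) (Real.toNNReal_pos.2 (by positivity))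
  · exact Real.toNNReal_pos.2 (inv_pos.2 (hf0 0))
  have hu' : (f 0)⁻¹ ≤ (u : ℝ) := Real.toNNReal_le_iff_le_coe.1 hu
  have hu0 : (0 : ℝ) < u := (inv_pos.2 (hf0 0)).trans_le hu'
  classical
  have hex : ∃ k, u * f k ≤ 1 := by
    have := (hlim.const_mul (u : ℝ)).eventually_le_const (u := 1) (by simp)
    exact this.exists
  have hle : u * f (Nat.find hex) ≤ 1 := Nat.find_spec hex
  refine (hA (Nat.find hex)).rinv_le_of_embeds hE hemb hC hle ?_
  change 1 ≤ 2 * u * f (Nat.find hex)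
  rcases h : Nat.find hex with _ | k
  · have := (inv_le_iff_one_le_mul₀ (hf0 0)).1 hu'
    linarith
  · have h₁ : ¬ u * f k ≤ 1 := Nat.find_min hex (by omega)
    have h₂ := mul_le_mul_of_nonneg_left (hstep k) hu0.le
    change u * f k ≤ u * (2 * f (k + 1)) at h₂
    linarith

/-- Test sets whose norms are unbounded, at most doubling in each step, reach all small `u`. -/
theorem precSmall_of_testSets (hE : E.IsBanachIdeal) {φ φ₁ φ₂ : YoungFunction}
    (hemb : (E.calderon φ).Embeds ((E.calderon φ₁).prod (E.calderon φ₂)))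
    {A : ℕ → Set Ω} (hA : ∀ k, E.IsTestSet (A k))
    (hstep : ∀ k, E.norm (chi μ (A (k + 1)) (hA (k + 1)).meas) ≤
      2 * E.norm (chi μ (A k) (hA k).meas))
    (hunb : ¬ BddAbove (range fun k => E.norm (chi μ (A k) (hA k).meas))) :
    φ.PrecSmall φ₁ φ₂ := by
  obtain ⟨C, hC, hemb⟩ := hemb
  set f : ℕ → ℝ := fun k => E.norm (chi μ (A k) (hA k).meas) with hf
  have hf0 : ∀ k, 0 < f k := fun k => (hA k).norm_pos
  refine ⟨16 * (C + 1).toNNReal, (f 0)⁻¹.toNNReal, ?_, ?_, fun u hu0 hu => ?_⟩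
  · exact mul_pos (by norm_num) (Real.toNNReal_pos.2 (by positivity))
  · exact Real.toNNReal_pos.2 (inv_pos.2 (hf0 0))
  have hu0' : (0 : ℝ) < u := by exact_mod_cast hu0
  have hu' : (u : ℝ) ≤ (f 0)⁻¹ := by
    rw [← NNReal.coe_le_coe, Real.coe_toNNReal _ (inv_pos.2 (hf0 0)).le] at hu
    exact hu
  classical
  have hex : ∃ k, 1 < u * f k := by
    by_contra! hcon
    refine hunb ⟨(u : ℝ)⁻¹, ?_⟩
    rintro _ ⟨k, rfl⟩
    rw [← one_div, le_div_iff₀' hu0']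
    exact hcon k
  have hlt : 1 < u * f (Nat.find hex) := Nat.find_spec hex
  rcases h : Nat.find hex with _ | k
  · rw [h] at hlt
    have := (le_inv_mul_iff₀ (hf0 0)).1 (hu'.trans_eq (mul_one _).symm)
    linarith
  · rw [h] at hlt
    have h₁ : ¬ 1 < u * f k := Nat.find_min hex (by omega)
    have h₂ := mul_le_mul_of_nonneg_left (hstep k) hu0'.le
    change u * f (k + 1) ≤ u * (2 * f k) at h₂
    refine (hA k).rinv_le_of_embeds hE hemb hC (not_lt.1 h₁) ?_
    change 1 ≤ 2 * u * f k
    linarith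

/-! ### Characteristic functions in symmetric spaces -/

theorem measure_lt_abs_chi {A : Set Ω} (hA : MeasurableSet A) {l : ℝ} (hl : 0 ≤ l) :
    μ {t | l < |chi μ A hA t|} = if l < 1 then μ A else 0 := by
  have : {t | l < |chi μ A hA t|} =ᵐ[μ] (if l < 1 then A else ∅ : Set Ω) := by
    filter_upwards [coeFn_chi (μ := μ) hA] with t ht
    apply propext
    change l < |chi μ A hA t| ↔ t ∈ (if l < 1 then A else ∅ : Set Ω)
    rw [ht]
    by_cases h : t ∈ A <;> by_cases h' : l < 1 <;> simp [h, h', hl]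
  rw [measure_congr this]
  split_ifs <;> simp

theorem equimeasurable_chi {A B : Set Ω} (hA : MeasurableSet A) (hB : MeasurableSet B)
    (h : μ A = μ B) : Equimeasurable (chi μ A hA) (chi μ B hB) := fun l hl => by
  rw [measure_lt_abs_chi hA hl, measure_lt_abs_chi hB hl, h]

theorem Symmetric.chi_mem_and_norm_eq (hS : E.Symmetric) {A B : Set Ω} (hA : MeasurableSet A)
    (hB : MeasurableSet B) (h : μ A = μ B) (hmem : chi μ A hA ∈ E.carrier) :
    chi μ B hB ∈ E.carrier ∧ E.norm (chi μ A hA) = E.norm (chi μ B hB) :=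
  hS _ _ (equimeasurable_chi hA hB h) hmem

theorem Symmetric.isTestSet (hE : E.IsBanachIdeal) (hS : E.Symmetric) {A : Set Ω}
    (hA : MeasurableSet A) (hmem : chi μ A hA ∈ E.carrier) (hμ : 0 < μ A)
    (hdiv : ∀ B, MeasurableSet B → B ⊆ A → μ A ≤ 2 * μ B →
      ∃ S, MeasurableSet S ∧ S ⊆ B ∧ μ S = μ (A \ S)) : E.IsTestSet A where
  meas := hA
  mem := hmem
  norm_pos := chi_norm_pos hE hA hmem hμ
  half B hB hBA hle := by
    obtain ⟨S, hSm, hSB, hS'⟩ := hdiv B hB hBA hle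
    obtain ⟨hmB, -⟩ := chi_mem_and_norm_le_of_subset hE hA hB hBA hmem
    obtain ⟨hmS, hnS⟩ := chi_mem_and_norm_le_of_subset hE hB hSm hSB hmB
    obtain ⟨hmD, hnD⟩ := hS.chi_mem_and_norm_eq hSm (hA.diff hSm) hS' hmS
    have := (chi_union_mem_and_norm_le hE hSm (hA.diff hSm) hA (by simp) hmS hmD).2
    linarith

/-- If test sets, whose norms at most double in each step, exhaust the space, then the norms are
unbounded unless the Fatou property puts the constant function `1` into `E`. -/
theorem precSmall_of_exhaustion (hE : E.IsBanachIdeal) (hF : E.Fatou)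
    (h1 : (1 : Ω →ₘ[μ] ℝ) ∉ E.carrier) {φ φ₁ φ₂ : YoungFunction}
    (hemb : (E.calderon φ).Embeds ((E.calderon φ₁).prod (E.calderon φ₂)))
    {A : ℕ → Set Ω} (hA : ∀ k, E.IsTestSet (A k)) (hmono : Monotone A)
    (hcov : ∀ᵐ t ∂μ, ∃ k, t ∈ A k)
    (hstep : ∀ k, E.norm (chi μ (A (k + 1)) (hA (k + 1)).meas) ≤
      2 * E.norm (chi μ (A k) (hA k).meas)) : φ.PrecSmall φ₁ φ₂ := by
  refine precSmall_of_testSets hE hemb hA hstep fun hbdd => h1 ?_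
  refine (hF (fun k => chi μ (A k) (hA k).meas) 1 (fun k => (hA k).mem) ?_ hbdd).1
  filter_upwards [ae_all_iff.2 fun k => coeFn_chi (μ := μ) (hA k).meas, hcov,
    AEEqFun.coeFn_one (α := Ω) (μ := μ) (β := ℝ)] with t h ⟨k, hk⟩ hone
  simp only [h, hone]
  refine ⟨fun n => indicator_nonneg (fun _ _ => zero_le_one) t, fun m n hmn =>
    indicator_le_indicator_of_subset (hmono hmn) (fun _ => zero_le_one) t, ?_⟩
  refine tendsto_const_nhds.congr' ?_
  filter_upwards [eventually_ge_atTop k] with n hn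
  simp [hmono hn hk]

theorem zero_mem_orderCont (hE : E.IsBanachIdeal) : (0 : Ω →ₘ[μ] ℝ) ∈ E.orderCont := by
  refine ⟨hE.zero_mem, fun y _ hae => ?_⟩
  have h0 : ∀ n, y n = 0 := fun n => by
    refine AEEqFun.ext ?_
    filter_upwards [hae, AEEqFun.coeFn_zero (μ := μ) (β := ℝ)] with t h₁ h₂
    have := h₁.1 n
    rw [h₂] at this ⊢
    simp only [Pi.zero_apply, abs_zero] at this ⊢
    exact le_antisymm this.2 this.1
  have hn : E.norm (0 : Ω →ₘ[μ] ℝ) = 0 := by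
    simpa using hE.norm_smul 0 0 hE.zero_mem
  simp [h0, hn]

end General

/-! ### Symmetric function spaces on the line -/

section Line

variable {ν : Measure ℝ} {E : FnSpace ν}

/-- A measure on the line below Lebesgue measure takes all intermediate values. -/
theorem exists_subset_measure_eq (hν : ν ≤ volume) {S : Set ℝ} (hS : MeasurableSet S) {a : ℝ≥0∞}
    (ha : a ≤ ν S) (ha' : a < ⊤) : ∃ T, MeasurableSet T ∧ T ⊆ S ∧ ν T = a := by
  rcases ha.eq_or_lt with rfl | ha
  · exact ⟨S, hS, Subset.rfl, rfl⟩
  have hfin : ∀ r : ℝ, ν (S ∩ Icc (-r) r) ≠ ⊤ := fun r =>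
    (((measure_mono inter_subset_right).trans (hν _)).trans_lt measure_Icc_lt_top).ne
  have hlip : LipschitzWith 2 fun r : ℝ => (ν (S ∩ Icc (-r) r)).toReal := by
    refine LipschitzWith.of_le_add_mul 2 fun x y => ?_
    have hsub : S ∩ Icc (-x) x ⊆ S ∩ Icc (-y) y ∪ (Icc (-x) (-y) ∪ Icc y x) := by
      rintro t ⟨htS, ht⟩
      by_cases h : t ∈ Icc (-y) y
      · exact Or.inl ⟨htS, h⟩
      · right
        rw [mem_Icc, not_and_or, not_le, not_le] at h
        exact h.imp (fun h => ⟨ht.1, h.le⟩) fun h => ⟨h.le, ht.2⟩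
    have hle : ν (S ∩ Icc (-x) x) ≤ ν (S ∩ Icc (-y) y) + ENNReal.ofReal (2 * dist x y) :=
      calc ν (S ∩ Icc (-x) x) ≤ ν (S ∩ Icc (-y) y) + (ν (Icc (-x) (-y)) + ν (Icc y x)) :=
            (measure_mono hsub).trans ((measure_union_le _ _).trans
              (add_le_add le_rfl (measure_union_le _ _)))
        _ ≤ ν (S ∩ Icc (-y) y) + (ENNReal.ofReal (dist x y) + ENNReal.ofReal (dist x y)) := by
            gcongr
            · refine (hν _).trans ?_
              rw [Real.volume_Icc]
              exact ENNReal.ofReal_le_ofReal (by rw [Real.dist_eq]; linarith [le_abs_self (x - y)])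
            · refine (hν _).trans ?_
              rw [Real.volume_Icc]
              exact ENNReal.ofReal_le_ofReal (le_abs_self _)
        _ = _ := by rw [← ENNReal.ofReal_add dist_nonneg dist_nonneg, two_mul]
    have := ENNReal.toReal_mono
      (ENNReal.add_ne_top.2 ⟨hfin y, ENNReal.ofReal_ne_top⟩) hle
    rwa [ENNReal.toReal_add (hfin y) ENNReal.ofReal_ne_top,
      ENNReal.toReal_ofReal (by positivity)] at this
  have hlim : Tendsto (fun n : ℕ => ν (S ∩ Icc (-(n : ℝ)) n)) atTop (𝓝 (ν S)) := by
    have hU : (⋃ n : ℕ, S ∩ Icc (-(n : ℝ)) n) = S := by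
      rw [← inter_iUnion, inter_eq_left]
      intro t _
      obtain ⟨n, hn⟩ := exists_nat_ge |t|
      exact mem_iUnion.2 ⟨n, abs_le.1 hn⟩
    have := tendsto_measure_iUnion_atTop (μ := ν) (s := fun n : ℕ => S ∩ Icc (-(n : ℝ)) n)
      fun m n hmn => by
        have : (m : ℝ) ≤ n := by exact_mod_cast hmn
        exact inter_subset_inter_right _ (Icc_subset_Icc (by linarith) this)
    rwa [hU] at this
  obtain ⟨n, hn⟩ := (hlim.eventually_const_lt ha).exists
  have h0 : ν (S ∩ Icc (-(0 : ℝ)) 0) = 0 := by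
    refine le_antisymm ?_ zero_le
    exact (measure_mono inter_subset_right).trans ((hν _).trans (by simp))
  obtain ⟨r, -, hr⟩ := intermediate_value_Icc (Nat.cast_nonneg (α := ℝ) n)
    hlip.continuous.continuousOn (show a.toReal ∈ Icc _ _ from
      ⟨by simp only [h0]; simp, ENNReal.toReal_mono (hfin n) hn.le⟩)
  exact ⟨S ∩ Icc (-r) r, hS.inter measurableSet_Icc, inter_subset_left,
    (ENNReal.toReal_eq_toReal_iff' (hfin r) ha'.ne).1 hr⟩

theorem Symmetric.chi_mem_and_norm_le (hν : ν ≤ volume) (hE : E.IsBanachIdeal)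
    (hS : E.Symmetric) {A B : Set ℝ} (hA : MeasurableSet A) (hB : MeasurableSet B)
    (hle : ν B ≤ ν A) (hfin : ν B < ⊤) (hmem : chi ν A hA ∈ E.carrier) :
    chi ν B hB ∈ E.carrier ∧ E.norm (chi ν B hB) ≤ E.norm (chi ν A hA) := by
  obtain ⟨T, hT, hTA, hTB⟩ := exists_subset_measure_eq hν hA hle hfin
  obtain ⟨h₁, h₂⟩ := chi_mem_and_norm_le_of_subset hE hA hT hTA hmem
  obtain ⟨h₃, h₄⟩ := hS.chi_mem_and_norm_eq hT hB hTB h₁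
  exact ⟨h₃, h₄ ▸ h₂⟩

theorem Symmetric.isTestSet_of_le_volume (hν : ν ≤ volume) (hE : E.IsBanachIdeal)
    (hS : E.Symmetric) {A : Set ℝ} (hA : MeasurableSet A) (hmem : chi ν A hA ∈ E.carrier)
    (hpos : 0 < ν A) (hfin : ν A < ⊤) : E.IsTestSet A := by
  refine hS.isTestSet hE hA hmem hpos fun B hB hBA hle => ?_
  have hhalf : ν A / 2 < ⊤ := ENNReal.div_lt_top hfin.ne (by simp)
  obtain ⟨S, hSm, hSB, hS'⟩ := exists_subset_measure_eq hν hB (a := ν A / 2)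
    (ENNReal.div_le_of_le_mul' hle) hhalf
  refine ⟨S, hSm, hSB, ?_⟩
  rw [measure_sdiff (hSB.trans hBA) hSm.nullMeasurableSet (hS' ▸ hhalf.ne), hS',
    ENNReal.sub_half hfin.ne]

/-- Below a nonzero element of `E_a` there are multiples of characteristic functions of sets of
measure `a / 2 ^ k`. They tend to `0` almost everywhere, by the Borel–Cantelli lemma, hence in
norm. -/
theorem precLarge_of_orderCont (hν : ν ≤ volume) (hE : E.IsBanachIdeal) (hS : E.Symmetric)
    (hne : E.orderCont ≠ {0}) {φ φ₁ φ₂ : YoungFunction}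
    (hemb : (E.calderon φ).Embeds ((E.calderon φ₁).prod (E.calderon φ₂))) :
    φ.PrecLarge φ₁ φ₂ := by
  obtain ⟨x, ⟨hx, hxa⟩, hx0⟩ : ∃ x ∈ E.orderCont, x ≠ 0 := by
    by_contra! h
    exact hne (eq_singleton_iff_unique_mem.2 ⟨zero_mem_orderCont hE, h⟩)
  have hSm : ∀ n : ℕ, MeasurableSet {t | 1 / ((n : ℝ) + 1) ≤ |x t|} := fun n =>
    measurableSet_le measurable_const (measurable_abs.comp x.measurable)
  obtain ⟨n, hn⟩ : ∃ n : ℕ, 0 < ν {t | 1 / ((n : ℝ) + 1) ≤ |x t|} := by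
    by_contra! h
    refine hx0 (AEEqFun.ext ?_)
    have h' : ∀ᵐ t ∂ν, ∀ n : ℕ, ¬ 1 / ((n : ℝ) + 1) ≤ |x t| :=
      ae_all_iff.2 fun n => ae_iff.2 (by simpa using h n)
    filter_upwards [h', AEEqFun.coeFn_zero (μ := ν) (β := ℝ)] with t h₁ h₂
    rw [h₂, Pi.zero_apply]
    by_contra hcon
    obtain ⟨n, hn⟩ := exists_nat_one_div_lt (abs_pos.2 hcon)
    exact h₁ n hn.le
  set δ : ℝ := 1 / ((n : ℝ) + 1) with hδ
  have hδ0 : 0 < δ := by positivity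
  set S := {t | δ ≤ |x t|} with hSdef
  set a : ℝ≥0∞ := min 1 (ν S) with ha
  have ha0 : 0 < a := lt_min one_pos hn
  have hatop : a < ⊤ := (min_le_left _ _).trans_lt ENNReal.one_lt_top
  have hex : ∀ k : ℕ, ∃ T, MeasurableSet T ∧ T ⊆ S ∧ ν T = a * 2⁻¹ ^ k := fun k => by
    have : a * 2⁻¹ ^ k ≤ a := mul_le_of_le_one_right' (pow_le_one₀ zero_le (by simp))
    exact exists_subset_measure_eq hν (hSm n) (this.trans (min_le_right _ _))
      (this.trans_lt hatop)
  choose T hT hTS hTν using hex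
  have hTtop : ∀ k, ν (T k) < ⊤ := fun k => by
    rw [hTν]
    exact ENNReal.mul_lt_top hatop (ENNReal.pow_lt_top (by simp))
  have hsmall : ∀ k, ∀ᵐ t ∂ν, 0 ≤ (δ • chi ν (T k) (hT k)) t ∧
      (δ • chi ν (T k) (hT k)) t ≤ |x t| ∧ (t ∉ T k → (δ • chi ν (T k) (hT k)) t = 0) := by
    intro k
    filter_upwards [coeFn_chi (hT k), AEEqFun.coeFn_smul δ (chi ν (T k) (hT k))] with t h₁ h₂
    rw [h₂, Pi.smul_apply, h₁]
    by_cases ht : t ∈ T k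
    · have : δ ≤ |x t| := hTS k ht
      simp [ht, hδ0.le, this]
    · simp [ht]
  have hδmem : ∀ k, δ • chi ν (T k) (hT k) ∈ E.carrier := fun k => by
    refine (hE.ideal x hx _ ?_).1
    filter_upwards [hsmall k] with t ht
    rw [abs_of_nonneg ht.1]
    exact ht.2.1
  have hmem : ∀ k, chi ν (T k) (hT k) ∈ E.carrier := fun k => by
    have := hE.smul_mem δ⁻¹ _ (hδmem k)
    rwa [smul_smul, inv_mul_cancel₀ hδ0.ne', one_smul] at this
  have htest : ∀ k, E.IsTestSet (T k) := fun k =>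
    hS.isTestSet_of_le_volume hν hE (hT k) (hmem k)
      (by rw [hTν]; exact ENNReal.mul_pos ha0.ne' (by simp)) (hTtop k)
  refine precLarge_of_testSets hE hemb htest (fun k => ?_) ?_
  · have hhalf : 2 * ν (T (k + 1)) = ν (T k) := by
      rw [hTν, hTν, pow_succ, mul_comm, mul_assoc, mul_assoc,
        ENNReal.inv_mul_cancel (by simp) (by simp), mul_one]
    obtain ⟨R, hR, hRT, hRν⟩ := exists_subset_measure_eq hν (hT k) (a := ν (T (k + 1)))
      (by rw [← hhalf, two_mul]; exact le_self_add) (hTtop _)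
    refine ((htest k).half R hR hRT (by rw [hRν, hhalf])).trans_eq ?_
    rw [(hS.chi_mem_and_norm_eq (hT (k + 1)) hR hRν.symm (hmem _)).2]
  · have hBC : ∀ᵐ t ∂ν, ∀ᶠ k in atTop, t ∉ T k := by
      refine ae_eventually_notMem ?_
      simp only [hTν]
      rw [ENNReal.tsum_mul_left, ENNReal.tsum_geometric]
      exact ENNReal.mul_ne_top hatop.ne (by simp)
    have hlim := hxa _ hδmem (by
      filter_upwards [ae_all_iff.2 hsmall, hBC] with t h₁ h₂
      refine ⟨fun k => ⟨(h₁ k).1, (h₁ k).2.1⟩, tendsto_const_nhds.congr' ?_⟩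
      filter_upwards [h₂] with k hk
      exact ((h₁ k).2.2 hk).symm)
    have := hlim.const_mul δ⁻¹
    rw [mul_zero] at this
    refine this.congr fun k => ?_
    rw [hE.norm_smul _ _ (hmem k), abs_of_pos hδ0, inv_mul_cancel_left₀ hδ0.ne']

/-- The test sets are the intervals `(0, 2 ^ k b)`. -/
theorem precSmall_of_not_linfty_embeds (hν : ν ≤ volume)
    (hν₀ : ∀ᵐ t ∂ν, 0 < t) (hνpos : ∀ b : ℝ, 0 < b → 0 < ν (Ioo 0 b))
    (hνdbl : ∀ b : ℝ, 0 < b → ν (Ico b (2 * b)) ≤ ν (Ioo 0 b))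
    (hE : E.IsBanachIdeal) (hS : E.Symmetric) (hF : E.Fatou)
    (hL : ¬ (Linfty ν).Embeds E) {φ φ₁ φ₂ : YoungFunction}
    (hemb : (E.calderon φ).Embeds ((E.calderon φ₁).prod (E.calderon φ₂))) :
    φ.PrecSmall φ₁ φ₂ := by
  obtain ⟨B, hB, -, hB0, hBtop, hBmem⟩ := hE.saturated (Ioo 0 1) measurableSet_Ioo
    (hνpos 1 one_pos)
  set b : ℝ := (ν B).toReal with hb
  have hb0 : 0 < b := ENNReal.toReal_pos hB0.ne' hBtop.ne
  have hm : ∀ k : ℕ, MeasurableSet (Ioo 0 (2 ^ k * b)) := fun k => measurableSet_Ioo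
  have hfin : ∀ k : ℕ, ν (Ioo 0 (2 ^ k * b)) < ⊤ := fun k =>
    (hν _).trans_lt measure_Ioo_lt_top
  have hstep : ∀ k : ℕ, chi ν _ (hm k) ∈ E.carrier → chi ν _ (hm (k + 1)) ∈ E.carrier ∧
      E.norm (chi ν _ (hm (k + 1))) ≤ 2 * E.norm (chi ν _ (hm k)) := by
    intro k hk
    have hle := hνdbl (2 ^ k * b) (by positivity)
    obtain ⟨h₁, h₂⟩ := hS.chi_mem_and_norm_le hν hE (hm k) measurableSet_Ico hle
      (hle.trans_lt (hfin k)) hk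
    obtain ⟨h₃, h₄⟩ := chi_union_mem_and_norm_le hE (hm k) measurableSet_Ico (hm (k + 1))
      (fun t ht => by
        rcases lt_or_ge t (2 ^ k * b) with h | h
        · exact Or.inl ⟨ht.1, h⟩
        · exact Or.inr ⟨h, by simpa [pow_succ', mul_assoc] using ht.2⟩) hk h₁
    exact ⟨h₃, by linarith⟩
  have hmem : ∀ k, chi ν _ (hm k) ∈ E.carrier := by
    intro k
    induction k with
    | zero =>
      refine (hS.chi_mem_and_norm_le hν hE hB (hm 0) ?_ (hfin 0) hBmem).1
      refine (hν _).trans ?_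
      simp [hb, ENNReal.ofReal_toReal hBtop.ne]
    | succ k ih => exact (hstep k ih).1
  refine precSmall_of_exhaustion hE hF (fun h1 => hL (linfty_embeds_of_one_mem hE h1)) hemb
    (fun k => hS.isTestSet_of_le_volume hν hE (hm k) (hmem k) (hνpos _ (by positivity)) (hfin k))
    (fun m n hmn => Ioo_subset_Ioo_right (by gcongr; norm_num)) ?_ fun k => (hstep k (hmem k)).2
  filter_upwards [hν₀] with t ht
  obtain ⟨k, hk⟩ := pow_unbounded_of_one_lt (t / b) one_lt_two
  exact ⟨k, ht, (div_lt_iff₀ hb0).1 hk⟩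

theorem ae_restrict_pos {I : Set ℝ} (hI : I = Ioo 0 1 ∨ I = Ioi 0) :
    ∀ᵐ t ∂volume.restrict I, 0 < t := by
  rcases hI with rfl | rfl
  · exact (ae_restrict_mem measurableSet_Ioo).mono fun t ht => ht.1
  · exact ae_restrict_mem measurableSet_Ioi

theorem restrict_Ioo_pos {I : Set ℝ} (hI : I = Ioo 0 1 ∨ I = Ioi 0) {b : ℝ} (hb : 0 < b) :
    0 < volume.restrict I (Ioo 0 b) := by
  rw [Measure.restrict_apply measurableSet_Ioo]
  rcases hI with rfl | rfl
  · simp [Ioo_inter_Ioo, hb]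
  · simp [Ioo_inter_Ioi, hb]

theorem restrict_Ico_le {I : Set ℝ} (hI : I = Ioo 0 1 ∨ I = Ioi 0) {b : ℝ} (hb : 0 < b) :
    volume.restrict I (Ico b (2 * b)) ≤ volume.restrict I (Ioo 0 b) := by
  rw [Measure.restrict_apply measurableSet_Ioo, Measure.restrict_apply measurableSet_Ico]
  rcases hI with rfl | rfl
  · calc volume (Ico b (2 * b) ∩ Ioo 0 1) ≤ volume (Ico b (min (2 * b) 1)) :=
          measure_mono fun t ht => ⟨ht.1.1, lt_min ht.1.2 ht.2.2⟩
      _ ≤ volume (Ioo 0 b ∩ Ioo 0 1) := by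
          rw [Ioo_inter_Ioo, Real.volume_Ico, Real.volume_Ioo]
          refine ENNReal.ofReal_le_ofReal ?_
          rcases min_cases (2 * b) 1 with h | h <;> rcases min_cases b 1 with h' | h' <;>
            simp only [max_self] <;> linarith
  · refine (measure_mono inter_subset_left).trans ?_
    rw [Ioo_inter_Ioi, Real.volume_Ico, Real.volume_Ioo]
    refine ENNReal.ofReal_le_ofReal ?_
    simp only [max_self]
    linarith

end Line

/-! ### Symmetric sequence spaces -/

section Sequence

variable {E : FnSpace (Measure.count : Measure ℕ)}

theorem one_notMem_of_orderCont_eq (hE : E.IsBanachIdeal) (hS : E.Symmetric)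
    (hoc : E.orderCont = E.carrier) : (1 : ℕ →ₘ[Measure.count] ℝ) ∉ E.carrier := by
  intro h1
  have hm : ∀ n : ℕ, MeasurableSet (Ici n) := fun n => measurableSet_Ici
  have hle : ∀ n : ℕ, ∀ᵐ t ∂(Measure.count : Measure ℕ),
      0 ≤ chi Measure.count _ (hm n) t ∧ chi Measure.count _ (hm n) t ≤
        |(1 : ℕ →ₘ[Measure.count] ℝ) t| ∧ (t < n → chi Measure.count _ (hm n) t = 0) := fun n => by
    filter_upwards [coeFn_chi (hm n), AEEqFun.coeFn_one (α := ℕ) (μ := Measure.count) (β := ℝ)]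
      with t h₁ h₂
    rw [h₁, h₂]
    by_cases h : n ≤ t <;> simp [h]
  have hmem : ∀ n : ℕ, chi Measure.count _ (hm n) ∈ E.carrier := fun n => by
    refine (hE.ideal 1 h1 _ ?_).1
    filter_upwards [hle n] with t ht
    rw [abs_of_nonneg ht.1]
    exact ht.2.1
  have hlim := (hoc.symm ▸ h1 : (1 : ℕ →ₘ[Measure.count] ℝ) ∈ E.orderCont).2 _ hmem (by
    filter_upwards [ae_all_iff.2 hle] with t ht
    refine ⟨fun n => ⟨(ht n).1, (ht n).2.1⟩, tendsto_const_nhds.congr' ?_⟩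
    filter_upwards [eventually_gt_atTop t] with n hn
    exact ((ht n).2.2 hn).symm)
  -- all the sets `{n, n + 1, …}` have the same measure, so their norms are equal
  have hconst : ∀ n : ℕ, E.norm (chi Measure.count _ (hm n)) =
      E.norm (chi Measure.count _ (hm 0)) := fun n => by
    refine (hS.chi_mem_and_norm_eq (hm n) (hm 0) ?_ (hmem n)).2
    rw [Measure.count_apply_infinite (Ici_infinite n), Measure.count_apply_infinite (Ici_infinite 0)]
  simp only [hconst] at hlim
  have h0 := chi_norm_pos hE (hm 0) (hmem 0) (by
    rw [Measure.count_apply_infinite (Ici_infinite 0)]; simp)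
  exact h0.ne' (tendsto_nhds_unique tendsto_const_nhds hlim)

theorem chi_Iio_mem (hE : E.IsBanachIdeal) (hS : E.Symmetric) (n : ℕ) :
    chi Measure.count (Iio n) measurableSet_Iio ∈ E.carrier := by
  obtain ⟨B, hB, -, hB0, -, hBmem⟩ := hE.saturated univ MeasurableSet.univ (by simp)
  obtain ⟨b, hb⟩ : B.Nonempty := nonempty_iff_ne_empty.2 fun h => by simp [h] at hB0
  have hsing : ∀ m : ℕ, chi Measure.count {m} (measurableSet_singleton m) ∈ E.carrier := fun m =>
    (hS.chi_mem_and_norm_eq (measurableSet_singleton b) (measurableSet_singleton m) (by simp)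
      (chi_mem_and_norm_le_of_subset hE hB (measurableSet_singleton b)
        (singleton_subset_iff.2 hb) hBmem).1).1
  induction n with
  | zero =>
    exact (chi_mem_and_norm_le_of_subset hE (measurableSet_singleton 0) measurableSet_Iio
      (by simp) (hsing 0)).1
  | succ n ih =>
    refine (chi_union_mem_and_norm_le hE measurableSet_Iio (measurableSet_singleton n)
      measurableSet_Iio (fun t ht => ?_) ih (hsing n)).1
    simp only [mem_Iio, mem_union, mem_singleton_iff] at ht ⊢
    omega

theorem count_Iio (n : ℕ) : Measure.count (Iio n) = (n : ℝ≥0∞) := by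
  rw [← Finset.coe_range, Measure.count_apply_finset, Finset.card_range]

theorem isTestSet_Iio (hE : E.IsBanachIdeal) (hS : E.Symmetric) {n : ℕ} (hn : 0 < n) :
    E.IsTestSet (Iio (2 * n)) := by
  refine hS.isTestSet hE measurableSet_Iio (chi_Iio_mem hE hS _) ?_ fun B hB hBA hle => ?_
  · rw [count_Iio]
    exact_mod_cast (by omega : 0 < 2 * n)
  · rw [count_Iio] at hle
    have hfin : B.Finite := (finite_Iio _).subset hBA
    lift B to Finset ℕ using hfin
    rw [Measure.count_apply_finset] at hle
    have hle' : n ≤ B.card := by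
      have : 2 * n ≤ 2 * B.card := by exact_mod_cast hle
      omega
    obtain ⟨S, hSB, hSn⟩ := Finset.exists_subset_card_eq hle'
    refine ⟨S, S.measurableSet, by exact_mod_cast hSB, ?_⟩
    have hsub : S ⊆ Finset.range (2 * n) := by
      rw [← Finset.coe_subset, Finset.coe_range]
      exact (Finset.coe_subset.2 hSB).trans hBA
    rw [← Finset.coe_range, ← Finset.coe_sdiff, Measure.count_apply_finset,
      Measure.count_apply_finset, Finset.card_sdiff_of_subset hsub, Finset.card_range, hSn]
    congr 1
    omega

theorem precSmall_of_orderCont_eq (hE : E.IsBanachIdeal) (hS : E.Symmetric) (hF : E.Fatou)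
    (hoc : E.orderCont = E.carrier) {φ φ₁ φ₂ : YoungFunction}
    (hemb : (E.calderon φ).Embeds ((E.calderon φ₁).prod (E.calderon φ₂))) :
    φ.PrecSmall φ₁ φ₂ := by
  refine precSmall_of_exhaustion hE hF (one_notMem_of_orderCont_eq hE hS hoc) hemb
    (A := fun k => Iio (2 * 2 ^ k)) (fun k => isTestSet_Iio hE hS (by positivity))
    (fun m n hmn => Iio_subset_Iio (by gcongr; norm_num))
    (.of_forall fun t => ⟨t, ?_⟩) fun k => ?_
  · have := Nat.lt_two_pow_self (n := t)
    exact mem_Iio.2 (by omega)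
  · have hmem := chi_Iio_mem hE hS (2 * 2 ^ k)
    obtain ⟨h₁, h₂⟩ := hS.chi_mem_and_norm_eq (B := Ico (2 * 2 ^ k) (2 * 2 ^ (k + 1)))
      measurableSet_Iio measurableSet_Ico (by
        rw [count_Iio, ← Finset.coe_Ico, Measure.count_apply_finset, Nat.card_Ico]
        congr 1
        rw [pow_succ]
        omega) hmem
    have := (chi_union_mem_and_norm_le hE measurableSet_Iio measurableSet_Ico
      (S := Iio (2 * 2 ^ (k + 1))) measurableSet_Iio (fun t ht => by
        rcases lt_or_ge t (2 * 2 ^ k) with h | h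
        · exact Or.inl h
        · exact Or.inr ⟨h, ht⟩) hmem h₁).2
    rw [← h₂] at this
    exact this.trans_eq (two_mul _).symm

end Sequence

end FnSpace

end CalderonLozanovskii

open CalderonLozanovskii FnSpace in
theorem theorem5 (φ₁ φ₂ φ : YoungFunction) :
    -- (a)
    (∀ (Ω : Type*) [MeasurableSpace Ω] (μ : Measure Ω) [SigmaFinite μ] (E : FnSpace μ),
      E.IsBanachIdeal → E.Fatou →
      (φ.PrecAll φ₁ φ₂ ∨
        (φ.PrecLarge φ₁ φ₂ ∧ (Linfty μ).Embeds E) ∨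
        (φ.PrecSmall φ₁ φ₂ ∧ E.Embeds (Linfty μ))) →
      (E.calderon φ).Embeds ((E.calderon φ₁).prod (E.calderon φ₂))) ∧
    -- (b)
    (∀ I : Set ℝ, I = Ioo 0 1 ∨ I = Ioi 0 →
      ∀ E : FnSpace (volume.restrict I),
      E.IsBanachIdeal → E.Symmetric → E.Fatou → E.orderCont ≠ {0} →
      (E.calderon φ).Embeds ((E.calderon φ₁).prod (E.calderon φ₂)) →
      φ.PrecLarge φ₁ φ₂) ∧
    -- (c)
    (∀ I : Set ℝ, I = Ioo 0 1 ∨ I = Ioi 0 →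
      ∀ E : FnSpace (volume.restrict I),
      E.IsBanachIdeal → E.Symmetric → E.Fatou → FullSupport E.orderCont →
      ¬ (Linfty (volume.restrict I)).Embeds E →
      (E.calderon φ).Embeds ((E.calderon φ₁).prod (E.calderon φ₂)) →
      φ.PrecSmall φ₁ φ₂) ∧
    -- (d)
    (∀ E : FnSpace (Measure.count : Measure ℕ),
      E.IsBanachIdeal → E.Symmetric → E.Fatou → E.orderCont = E.carrier →
      (E.calderon φ).Embeds ((E.calderon φ₁).prod (E.calderon φ₂)) →
      φ.PrecSmall φ₁ φ₂) := by
  refine ⟨?_, ?_, ?_, ?_⟩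
  · rintro Ω _ μ _ E hE - (h | ⟨h, hL⟩ | ⟨h, hL⟩)
    · exact embeds_prod_of_precAll hE h
    · exact embeds_prod_of_precLarge hE h hL
    · exact embeds_prod_of_precSmall hE h hL
  · intro I _ E hE hS _ hne hemb
    exact precLarge_of_orderCont Measure.restrict_le_self hE hS hne hemb
  · intro I hI E hE hS hF _ hL hemb
    exact precSmall_of_not_linfty_embeds Measure.restrict_le_self (ae_restrict_pos hI)
      (fun _ => restrict_Ioo_pos hI) (fun _ => restrict_Ico_le hI) hE hS hF hL hemb
  · intro E hE hS hF hoc hemb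
    exact precSmall_of_orderCont_eq hE hS hF hoc hemb
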